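/- Let $H$ be a separable complex Hilbert space, let $\mathcal T(H)$ be the trace-class operators on $H$ with the trace norm, and call a positive operator $\rho\in\mathcal T(H)$ with $\operatorname{Tr}\rho=1$ a state. Inner products are linear in the second argument and $xy^*$ denotes the operator $z\mapsto\langle y,z\rangle x$. A state on $R\otimes H$ (Hilbert space tensor product) is countably separable if it equals a trace-norm convergent sum $\sum_{i=1}^\infty p_i\,g_i\otimes h_i$ with states $g_i$ on $R$, $h_i$ on $H$, $p_i>0$ and $\sum_i p_i=1$. A completely positive trace-preserving linear map (channel) $\Phi:\mathcal T(H)\to\mathcal T(H)$ is strongly entanglement breaking (SEB) if for every Hilbert space $R$ and every state $\rho$ on $R\otimes H$ the operator $(I_R\otimes\Phi)(\rho)$ is countably separable, where $I_R\otimes\Phi$ is the trace-norm continuous linear map with $A\otimes B\mapsto A\otimes\Phi(B)$ (its existence is part of the claim). **Theorem.** Let $\{e_i\}$ be any orthonormal basis of $H$ and let $\Phi:\mathcal T(H)\to\mathcal T(H)$ be a channel whose range is commutative, i.e. $\Phi(X)\Phi(Y)=\Phi(Y)\Phi(X)$ for all $X,Y\in\mathcal T(H)$. Then $\Phi$ is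 SEB. Moreover, for any scalars $\lambda_i>0$ with $\sum_i\lambda_i=1$, the weighted Choi series $$\sigma:=\sum_{i,j}\sqrt{\lambda_i\lambda_j}\;e_ie_j^*\otimes\Phi(e_ie_j^*)$$ (the trace-norm limit of the partial sums over $i,j\in S$, for finite index sets $S$ increasing to the whole index set) converges to a state on $H\otimes H$; $\sigma$ is countably separable and can be written as a trace-norm convergent sum $$\sigma=\sum_{k}p_k\,\rho_k\otimes v_kv_k^*,$$ over a finite or countably infinite index set, with $\{v_k\}$ an orthonormal family in $H$, states $\rho_k\in\mathcal T(H)$ and scalars $p_k>0$ with $\sum_kp_k=1$. With these $p_k,\rho_k,v_k$ there are a unitary $U\in B(H)$ and positive operators $F_k\in B(H)^+$ with matrix entries $$\langle e_i,F_ke_j\rangle=\frac{p_k}{\sqrt{\lambda_i\lambda_j}}\,\langle e_j,\rho_ke_i\rangle\qquad\text{for all } i,j$$ (so $F_k$ is the Schur product of $\big[p_k/\sqrt{\lambda_i\lambda_j}\big]_{i,j}$ with the transpose of the matrix of $\rho_k$), such that $\sum_kF_k=I_H$ in the weak operator topology and $$\Phi(X)=\sum_k R_k\operatorname{Tr}(XF_k),\qquad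 R_k=(Uv_k)(Uv_k)^*,\qquad X\in\mathcal T(H),$$ with convergence in trace norm. -/

import Mathlib

open Filter Topology TensorProduct
open scoped ComplexOrder InnerProductSpace

universe u v w

namespace QChannel

section TraceClassOperators

variable {H : Type u} [NormedAddCommGroup H] [InnerProductSpace ℂ H]

/-- `A = ∑ i, x i (y i)^*` with `∑ i, ‖x i‖ ‖y i‖ < ∞`.  Here `rankOne ℂ x y` is the operator
`x y^* : z ↦ ⟪y, z⟫ x`; the series converges absolutely in operator norm. -/
def IsRankOneSeries {ι : Type*} (x y : ι → H) (A : H →L[ℂ] H) : Prop :=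
  Summable (fun i => ‖x i‖ * ‖y i‖) ∧
    HasSum (fun i => InnerProductSpace.rankOne ℂ (x i) (y i)) A

/-- Trace-class (that is, nuclear) operators on a Hilbert space: the operators
`A = ∑ n, x n (y n)^*` with `∑ n, ‖x n‖ ‖y n‖ < ∞`. -/
def IsTraceClass (A : H →L[ℂ] H) : Prop :=
  ∃ x y : ℕ → H, IsRankOneSeries x y A

/-- The set of all values `∑ n, ‖x n‖ ‖y n‖` over the representations `A = ∑ n, x n (y n)^*`. -/
def traceNormSet (A : H →L[ℂ] H) : Set ℝ :=
  {c | ∃ x y : ℕ → H, IsRankOneSeries x y A ∧ c = ∑' n, ‖x n‖ * ‖y n‖}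

/-- The trace norm `‖A‖₁` of a trace-class operator: the infimum of `∑ n, ‖x n‖ ‖y n‖` over all
representations `A = ∑ n, x n (y n)^*` (it is attained by the singular value decomposition, where
it is the sum of the singular values, that is, the trace of `|A|`). -/
noncomputable def traceNorm (A : H →L[ℂ] H) : ℝ := sInf (traceNormSet A)

lemma IsRankOneSeries.reindex {ι κ : Type*} (f : κ ≃ ι) {x y : ι → H} {A : H →L[ℂ] H}
    (h : IsRankOneSeries x y A) : IsRankOneSeries (x ∘ f) (y ∘ f) A := by
  refine ⟨?_, ?_⟩
  · exact (f.summable_iff (f := fun i => ‖x i‖ * ‖y i‖)).mpr h.1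
  · exact (f.hasSum_iff (f := fun i => InnerProductSpace.rankOne ℂ (x i) (y i))).mpr h.2

lemma IsRankOneSeries.mem {ι : Type*} (f : ℕ ≃ ι) {x y : ι → H} {A : H →L[ℂ] H}
    (h : IsRankOneSeries x y A) : (∑' i, ‖x i‖ * ‖y i‖) ∈ traceNormSet A :=
  ⟨x ∘ f, y ∘ f, h.reindex f, (f.tsum_eq (fun i => ‖x i‖ * ‖y i‖)).symm⟩

lemma IsTraceClass.nonempty {A : H →L[ℂ] H} (h : IsTraceClass A) : (traceNormSet A).Nonempty := by
  obtain ⟨x, y, hxy⟩ := h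
  exact ⟨_, x, y, hxy, rfl⟩

lemma isTraceClass_of_mem {A : H →L[ℂ] H} {c : ℝ} (h : c ∈ traceNormSet A) : IsTraceClass A := by
  obtain ⟨x, y, hxy, _⟩ := h
  exact ⟨x, y, hxy⟩

lemma norm_le_of_mem {A : H →L[ℂ] H} {c : ℝ} (h : c ∈ traceNormSet A) : ‖A‖ ≤ c := by
  obtain ⟨x, y, ⟨hs, hA⟩, rfl⟩ := h
  rw [← hA.tsum_eq]
  refine (norm_tsum_le_tsum_norm (by simpa using hs)).trans (le_of_eq ?_)
  simp

lemma bddBelow_traceNormSet (A : H →L[ℂ] H) : BddBelow (traceNormSet A) :=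
  ⟨‖A‖, fun _ hc => norm_le_of_mem hc⟩

lemma norm_le_traceNorm {A : H →L[ℂ] H} (h : IsTraceClass A) : ‖A‖ ≤ traceNorm A :=
  le_csInf h.nonempty fun _ hc => norm_le_of_mem hc

lemma mem_add {A B : H →L[ℂ] H} {a b : ℝ} (ha : a ∈ traceNormSet A) (hb : b ∈ traceNormSet B) :
    a + b ∈ traceNormSet (A + B) := by
  obtain ⟨x, y, ⟨hs, hA⟩, rfl⟩ := ha
  obtain ⟨x', y', ⟨hs', hB⟩, rfl⟩ := hb
  have hn : HasSum (fun i : ℕ ⊕ ℕ => ‖Sum.elim x x' i‖ * ‖Sum.elim y y' i‖)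
      ((∑' n, ‖x n‖ * ‖y n‖) + ∑' n, ‖x' n‖ * ‖y' n‖) :=
    HasSum.sum (f := fun i : ℕ ⊕ ℕ => ‖Sum.elim x x' i‖ * ‖Sum.elim y y' i‖) hs.hasSum hs'.hasSum
  have ho : HasSum (fun i : ℕ ⊕ ℕ => InnerProductSpace.rankOne ℂ (Sum.elim x x' i)
      (Sum.elim y y' i)) (A + B) :=
    HasSum.sum (f := fun i : ℕ ⊕ ℕ => InnerProductSpace.rankOne ℂ (Sum.elim x x' i)
      (Sum.elim y y' i)) hA hB
  have h : IsRankOneSeries (Sum.elim x x') (Sum.elim y y') (A + B) := ⟨hn.summable, ho⟩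
  have := h.mem Equiv.natSumNatEquivNat.symm
  rwa [hn.tsum_eq] at this

lemma mem_smul {A : H →L[ℂ] H} {a : ℝ} (c : ℂ) (ha : a ∈ traceNormSet A) :
    ‖c‖ * a ∈ traceNormSet (c • A) := by
  obtain ⟨x, y, ⟨hs, hA⟩, rfl⟩ := ha
  refine ⟨fun n => c • x n, y, ⟨?_, ?_⟩, ?_⟩
  · simpa [norm_smul, mul_assoc] using hs.mul_left ‖c‖
  · simpa using hA.const_smul c
  · simp [norm_smul, mul_assoc, tsum_mul_left]

lemma mem_rankOne (x y : H) : ‖x‖ * ‖y‖ ∈ traceNormSet (InnerProductSpace.rankOne ℂ x y) := by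
  have h1 : HasSum (fun n : ℕ => ‖(Pi.single 0 x : ℕ → H) n‖ * ‖(Pi.single 0 y : ℕ → H) n‖)
      (‖x‖ * ‖y‖) := by
    convert! hasSum_single (f := fun n : ℕ => ‖(Pi.single 0 x : ℕ → H) n‖ *
      ‖(Pi.single 0 y : ℕ → H) n‖) 0 (fun n hn => by simp [hn]) using 1
  refine ⟨Pi.single 0 x, Pi.single 0 y, ⟨h1.summable, ?_⟩, h1.tsum_eq.symm⟩
  convert! hasSum_single (f := fun n : ℕ => InnerProductSpace.rankOne ℂ
    ((Pi.single 0 x : ℕ → H) n) ((Pi.single 0 y : ℕ → H) n)) 0 (fun n hn => by simp [hn]) using 1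

lemma mem_zero : (0 : ℝ) ∈ traceNormSet (0 : H →L[ℂ] H) := by
  simpa using mem_rankOne (0 : H) 0

variable (H) in
/-- The linear space of trace-class operators. -/
def traceClassSubmodule : Submodule ℂ (H →L[ℂ] H) where
  carrier := {A | IsTraceClass A}
  add_mem' := by
    rintro A B ⟨x, y, h⟩ ⟨x', y', h'⟩
    exact isTraceClass_of_mem (mem_add ⟨x, y, h, rfl⟩ ⟨x', y', h', rfl⟩)
  zero_mem' := isTraceClass_of_mem mem_zero
  smul_mem' := by
    rintro c A ⟨x, y, h⟩
    exact isTraceClass_of_mem (mem_smul c ⟨x, y, h, rfl⟩)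

variable (H) in
/-- The space `T(H)` of trace-class operators on `H`. It carries the trace norm (see below), not
the operator norm. -/
def TraceClass : Type u := traceClassSubmodule H

namespace TraceClass

noncomputable instance : AddCommGroup (TraceClass H) :=
  inferInstanceAs (AddCommGroup (traceClassSubmodule H))

noncomputable instance : Module ℂ (TraceClass H) :=
  inferInstanceAs (Module ℂ (traceClassSubmodule H))

variable (H) in
/-- A trace-class operator as a bounded operator. -/
noncomputable def toOpₗ : TraceClass H →ₗ[ℂ] (H →L[ℂ] H) := (traceClassSubmodule H).subtype

/-- A trace-class operator as a bounded operator. -/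
noncomputable def toOp (A : TraceClass H) : H →L[ℂ] H := toOpₗ H A

lemma isTraceClass (A : TraceClass H) : IsTraceClass A.toOp := A.2

lemma toOp_injective : Function.Injective (toOp : TraceClass H → (H →L[ℂ] H)) :=
  Subtype.val_injective

@[simp] lemma toOp_zero : (0 : TraceClass H).toOp = 0 := rfl
@[simp] lemma toOp_add (A B : TraceClass H) : (A + B).toOp = A.toOp + B.toOp := rfl
@[simp] lemma toOp_neg (A : TraceClass H) : (-A).toOp = -A.toOp := rfl
@[simp] lemma toOp_smul (c : ℂ) (A : TraceClass H) : (c • A).toOp = c • A.toOp := rfl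

lemma traceNorm_smul_le (c : ℂ) (A : TraceClass H) :
    traceNorm (c • A).toOp ≤ ‖c‖ * traceNorm A.toOp := by
  rcases eq_or_ne c 0 with rfl | hc
  · rw [zero_smul, norm_zero, zero_mul]
    exact csInf_le (bddBelow_traceNormSet _) mem_zero
  · have hc' : 0 < ‖c‖ := norm_pos_iff.mpr hc
    rw [← div_le_iff₀' hc']
    refine le_csInf A.isTraceClass.nonempty fun a ha => ?_
    rw [div_le_iff₀' hc']
    exact csInf_le (bddBelow_traceNormSet _) (mem_smul c ha)

variable (H) in
/-- The trace norm is a norm on `T(H)`. -/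
noncomputable def traceGroupNorm : AddGroupNorm (TraceClass H) where
  toFun A := traceNorm A.toOp
  map_zero' := le_antisymm (csInf_le (bddBelow_traceNormSet _) mem_zero)
    ((norm_nonneg _).trans (norm_le_traceNorm (isTraceClass _)))
  add_le' A B := by
    have key : ∀ a ∈ traceNormSet A.toOp, ∀ b ∈ traceNormSet B.toOp,
        traceNorm (A + B).toOp ≤ a + b := fun a ha b hb =>
      csInf_le (bddBelow_traceNormSet _) (mem_add ha hb)
    have h1 : ∀ a ∈ traceNormSet A.toOp, traceNorm (A + B).toOp - a ≤ traceNorm B.toOp :=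
      fun a ha => le_csInf B.isTraceClass.nonempty fun b hb => by
        linarith [key a ha b hb]
    have h2 : traceNorm (A + B).toOp - traceNorm B.toOp ≤ traceNorm A.toOp :=
      le_csInf A.isTraceClass.nonempty fun a ha => by linarith [h1 a ha]
    linarith
  neg' A := by
    apply le_antisymm
    · simpa using traceNorm_smul_le (-1) A
    · simpa using traceNorm_smul_le (-1) (-A)
  eq_zero_of_map_eq_zero' A h := by
    apply toOp_injective
    have h' := norm_le_traceNorm A.isTraceClass
    have h'' : traceNorm A.toOp = 0 := h
    rw [h''] at h'
    simpa using h'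

/-- `T(H)` is normed by the trace norm. -/
noncomputable instance : NormedAddCommGroup (TraceClass H) :=
  (traceGroupNorm H).toNormedAddCommGroup

lemma norm_def (A : TraceClass H) : ‖A‖ = traceNorm A.toOp := rfl

noncomputable instance : NormedSpace ℂ (TraceClass H) where
  norm_smul_le := traceNorm_smul_le

/-- The rank-one operator `x y^* : z ↦ ⟪y, z⟫ x` as a trace-class operator. -/
noncomputable def rankOne (x y : H) : TraceClass H :=
  ⟨InnerProductSpace.rankOne ℂ x y, isTraceClass_of_mem (mem_rankOne x y)⟩

end TraceClass

/-- The trace `∑ i, ⟪b i, A b i⟫` of an operator, computed in a chosen Hilbert basis `b`. For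
trace-class operators, the only ones it is applied to, the series converges absolutely and its
sum does not depend on the basis. -/
noncomputable def trace [CompleteSpace H] (A : H →L[ℂ] H) : ℂ :=
  ∑' i : (exists_hilbertBasis ℂ H).choose,
    ⟪(exists_hilbertBasis ℂ H).choose_spec.choose i,
      A ((exists_hilbertBasis ℂ H).choose_spec.choose i)⟫_ℂ

/-- States: positive trace-class operators of trace one. -/
def IsState [CompleteSpace H] (ρ : TraceClass H) : Prop :=
  ρ.toOp.IsPositive ∧ trace ρ.toOp = 1

end TraceClassOperators

section Tensor

variable {R : Type v} [NormedAddCommGroup R] [InnerProductSpace ℂ R]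
variable {H : Type u} [NormedAddCommGroup H] [InnerProductSpace ℂ H]

variable (R H) in
/-- The Hilbert space tensor product: the completion of the algebraic tensor product for the inner
product with `⟪a ⊗ b, c ⊗ d⟫ = ⟪a, c⟫ ⟪b, d⟫`. -/
abbrev HTensor : Type (max v u) := UniformSpace.Completion (R ⊗[ℂ] H)

/-- The elementary tensor `x ⊗ y` in the Hilbert space tensor product. -/
noncomputable def htmul (x : R) (y : H) : HTensor R H := ((x ⊗ₜ[ℂ] y : R ⊗[ℂ] H) : HTensor R H)

/-- The tensor product `A ⊗ B` of bounded operators: the continuous extension of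
`x ⊗ y ↦ A x ⊗ B y`. -/
noncomputable def opTensor (A : R →L[ℂ] R) (B : H →L[ℂ] H) :
    HTensor R H →L[ℂ] HTensor R H :=
  (TensorProduct.mapL A B).completion

lemma inner_htmul (x x' : R) (y y' : H) :
    ⟪htmul x y, htmul x' y'⟫_ℂ = ⟪x, x'⟫_ℂ * ⟪y, y'⟫_ℂ := by
  simp [htmul]

lemma norm_htmul (x : R) (y : H) : ‖htmul x y‖ = ‖x‖ * ‖y‖ := by
  simp [htmul]

lemma opTensor_htmul (A : R →L[ℂ] R) (B : H →L[ℂ] H) (x : R) (y : H) :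
    opTensor A B (htmul x y) = htmul (A x) (B y) := by
  simp [opTensor, htmul]

lemma htensor_op_ext {S T : HTensor R H →L[ℂ] HTensor R H}
    (h : ∀ a b a' b', ⟪htmul a b, S (htmul a' b')⟫_ℂ = ⟪htmul a b, T (htmul a' b')⟫_ℂ) :
    S = T := by
  have h0 : ((0 : R ⊗[ℂ] H) : HTensor R H) = 0 := UniformSpace.Completion.coe_zero
  have h1 : ∀ (z z' : R ⊗[ℂ] H), ⟪(z : HTensor R H), S (z' : HTensor R H)⟫_ℂ =
      ⟪(z : HTensor R H), T (z' : HTensor R H)⟫_ℂ := by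
    intro z z'
    induction z using TensorProduct.induction_on with
    | zero => rw [h0]; simp only [inner_zero_left]
    | add z1 z2 h1 h2 =>
      simp only [UniformSpace.Completion.coe_add, inner_add_left, h1, h2]
    | tmul a b =>
      induction z' using TensorProduct.induction_on with
      | zero => rw [h0]; simp only [map_zero, inner_zero_right]
      | add z1 z2 h1 h2 =>
        simp only [UniformSpace.Completion.coe_add, map_add, inner_add_right, h1, h2]
      | tmul a' b' => exact h a b a' b'
  have h2 : ∀ z z' : HTensor R H, ⟪z, S z'⟫_ℂ = ⟪z, T z'⟫_ℂ := by
    intro z z'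
    refine UniformSpace.Completion.induction_on₂ z z' (isClosed_eq ?_ ?_) h1
    · fun_prop
    · fun_prop
  ext1 z'
  exact ext_inner_left ℂ fun z => h2 z z'

lemma hasSum_inner_apply {ι : Type*} {T : ι → H →L[ℂ] H} {A : H →L[ℂ] H} (h : HasSum T A)
    (a a' : H) : HasSum (fun i => ⟪a, T i a'⟫_ℂ) ⟪a, A a'⟫_ℂ := by
  have h1 : HasSum (fun i => T i a') (A a') := h.mapL (ContinuousLinearMap.apply ℂ H a')
  exact h1.mapL (innerSL ℂ a)

lemma hasSum_inner_rankOne {ι : Type*} {x y : ι → H} {A : H →L[ℂ] H}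
    (h : HasSum (fun i => InnerProductSpace.rankOne ℂ (x i) (y i)) A) (a a' : H) :
    HasSum (fun i => ⟪a, x i⟫_ℂ * ⟪y i, a'⟫_ℂ) ⟪a, A a'⟫_ℂ :=
  (hasSum_inner_apply h a a').congr_fun
    fun i => (InnerProductSpace.inner_right_rankOne_apply a (x i) (y i) a').symm

lemma hasSum_mul_mul {f g : ℕ → ℂ} {s t : ℂ} (hf : HasSum f s) (hg : HasSum g t) :
    HasSum (fun n : ℕ × ℕ => f n.1 * g n.2) (s * t) :=
  hf.mul hg (summable_mul_of_summable_norm hf.summable.norm hg.summable.norm)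

lemma isRankOneSeries_tensor {x y : ℕ → R} {x' y' : ℕ → H} {A : R →L[ℂ] R} {B : H →L[ℂ] H}
    (hA : IsRankOneSeries x y A) (hB : IsRankOneSeries x' y' B) :
    IsRankOneSeries (fun n : ℕ × ℕ => htmul (x n.1) (x' n.2))
      (fun n : ℕ × ℕ => htmul (y n.1) (y' n.2)) (opTensor A B) := by
  have hs : Summable (fun n : ℕ × ℕ => ‖htmul (x n.1) (x' n.2)‖ * ‖htmul (y n.1) (y' n.2)‖) := by
    refine (hA.1.mul_of_nonneg hB.1 (fun _ => by positivity) (fun _ => by positivity)).congr ?_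
    intro n
    simp only [norm_htmul]
    ring
  refine ⟨hs, ?_⟩
  have hs' : Summable (fun n : ℕ × ℕ => InnerProductSpace.rankOne ℂ (htmul (x n.1) (x' n.2))
      (htmul (y n.1) (y' n.2))) := by
    refine Summable.of_norm (hs.congr fun n => ?_)
    rw [InnerProductSpace.norm_rankOne]
  obtain ⟨S, hS⟩ := hs'
  have hST : S = opTensor A B := by
    apply htensor_op_ext
    intro a b a' b'
    have e3 := hasSum_inner_rankOne hS (htmul a b) (htmul a' b')
    have e4 := hasSum_mul_mul (hasSum_inner_rankOne hA.2 a a') (hasSum_inner_rankOne hB.2 b b')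
    rw [opTensor_htmul, inner_htmul]
    refine e3.unique (e4.congr_fun fun n => ?_)
    rw [inner_htmul, inner_htmul]
    exact mul_mul_mul_comm _ _ _ _
  rwa [← hST]

/-- The tensor product `A ⊗ B` of trace-class operators. -/
noncomputable def TraceClass.tensor (A : TraceClass R) (B : TraceClass H) :
    TraceClass (HTensor R H) :=
  ⟨opTensor A.toOp B.toOp, by
    obtain ⟨x, y, hA⟩ := A.isTraceClass
    obtain ⟨x', y', hB⟩ := B.isTraceClass
    exact isTraceClass_of_mem ((isRankOneSeries_tensor hA hB).mem Nat.pairEquiv.symm)⟩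

/-- Countably separable states on `R ⊗ H`: `ρ = ∑ i, p i • (g i ⊗ h i)` (convergence in trace norm)
with states `g i`, `h i` and `p i > 0`, `∑ i, p i = 1`. -/
def IsCountablySeparable [CompleteSpace R] [CompleteSpace H] (ρ : TraceClass (HTensor R H)) :
    Prop :=
  ∃ (p : ℕ → ℝ) (g : ℕ → TraceClass R) (h : ℕ → TraceClass H),
    (∀ i, 0 < p i) ∧ HasSum p 1 ∧ (∀ i, IsState (g i)) ∧ (∀ i, IsState (h i)) ∧
    HasSum (fun i => (p i : ℂ) • (g i).tensor (h i)) ρ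

end Tensor

section Channels

variable {H : Type u} [NormedAddCommGroup H] [InnerProductSpace ℂ H] [CompleteSpace H]
variable {K : Type v} [NormedAddCommGroup K] [InnerProductSpace ℂ K] [CompleteSpace K]

/-- The block operator `[A i j]` on `H ⊕ ⋯ ⊕ H` (`n` summands) is positive semidefinite. -/
def IsPositiveBlock {n : ℕ} (A : Fin n → Fin n → TraceClass H) : Prop :=
  ∀ x : Fin n → H, 0 ≤ ∑ i, ∑ j, ⟪x i, (A i j).toOp (x j)⟫_ℂ

/-- Complete positivity: for all `n`, applying `Φ` entrywise preserves positivity of `n × n` block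
operators with trace-class entries. -/
def IsCompletelyPositive (Φ : TraceClass H →ₗ[ℂ] TraceClass K) : Prop :=
  ∀ (n : ℕ) (A : Fin n → Fin n → TraceClass H), IsPositiveBlock A →
    IsPositiveBlock (fun i j => Φ (A i j))

/-- Quantum channels: completely positive and trace-preserving linear maps `T(H) → T(K)`. -/
structure IsChannel (Φ : TraceClass H →ₗ[ℂ] TraceClass K) : Prop where
  completelyPositive : IsCompletelyPositive Φ
  tracePreserving : ∀ X : TraceClass H, trace (Φ X).toOp = trace X.toOp

/-- `Ψ = I_R ⊗ Φ`: the (unique) trace-norm continuous linear map `T(R ⊗ H) → T(R ⊗ K)` with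
`Ψ (A ⊗ B) = A ⊗ Φ B`. -/
def IsAmpliation {R : Type w} [NormedAddCommGroup R] [InnerProductSpace ℂ R]
    (Φ : TraceClass H →ₗ[ℂ] TraceClass K)
    (Ψ : TraceClass (HTensor R H) →L[ℂ] TraceClass (HTensor R K)) : Prop :=
  ∀ (A : TraceClass R) (B : TraceClass H), Ψ (A.tensor B) = A.tensor (Φ B)

/-- Strongly entanglement breaking maps: for every Hilbert space `R` and every state `ρ` on
`R ⊗ H`, the output `(I_R ⊗ Φ) ρ` is countably separable. -/
def IsStronglyEntanglementBreaking (Φ : TraceClass H →ₗ[ℂ] TraceClass K) : Prop :=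
  ∀ (R : Type w) [NormedAddCommGroup R] [InnerProductSpace ℂ R] [CompleteSpace R],
    ∃ Ψ : TraceClass (HTensor R H) →L[ℂ] TraceClass (HTensor R K), IsAmpliation Φ Ψ ∧
      ∀ ρ : TraceClass (HTensor R H), IsState ρ → IsCountablySeparable (Ψ ρ)

/-- The range of `Φ` is commutative. -/
def HasCommutativeRange (Φ : TraceClass H →ₗ[ℂ] TraceClass K) : Prop :=
  ∀ X Y : TraceClass H, (Φ X).toOp * (Φ Y).toOp = (Φ Y).toOp * (Φ X).toOp

/-- `σ = ∑ i j, √(l i * l j) • (e i (e j)^* ⊗ Φ (e i (e j)^*))`, the double series being the limit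
in trace norm of its partial sums over the finite squares `s × s`. -/
def IsWeightedChoi {ι : Type*} (Φ : TraceClass H →ₗ[ℂ] TraceClass K) (e : ι → H) (l : ι → ℝ)
    (σ : TraceClass (HTensor H K)) : Prop :=
  Tendsto (fun s : Finset ι => ∑ i ∈ s, ∑ j ∈ s, (√(l i * l j) : ℂ) •
    (TraceClass.rankOne (e i) (e j)).tensor (Φ (TraceClass.rankOne (e i) (e j)))) atTop (𝓝 σ)

end Channels

end QChannel

namespace QChannel

/-! A channel with commutative range is a measurement followed by a preparation. The images of
positive operators are commuting, compact and self-adjoint, so some orthonormal basis `w k`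
diagonalises all of them, hence the whole range, since positive operators span `T(H)`
(`exists_hilbertBasis_joint_eigenvectors`, `exists_positive_decomposition`). The diagonal entries
`⟪w k, Φ(X) w k⟫` are bounded positive functionals of `X`, so they equal `Tr (X F k)` with `F k ≥
0`, and trace preservation says `∑ F k = I` weakly. This is `exists_measure_prepare`, already the
final formula for `Φ`.

Splitting `F k = ∑ m, a k m (a k m)^*` through its square root gives a Parseval frame `a` and Kraus
operators `w k (a k m)^*` for `Φ`. The ampliation has Kraus operators `I ⊗ w k (a k m)^*`, which
send any vector `z` to a product vector: the slice of `z` along `a k m`, tensored with `w k`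
(`exists_ampliation`). Expanding a state into rank-one operators therefore gives an output that is a
trace-norm convergent mixture of pure product states, so it is countably separable.

For the Choi series, `σ = (I ⊗ Φ)(ω ω^*)` with the unit vector `ω = ∑ √(l i) e i ⊗ e i`. Collecting
the terms that share `w k` gives `σ = ∑ T k ⊗ w k (w k)^*`, and slicing `ω` along a vector
conjugates its coordinates and weights them by `√(l i)`. Hence the matrix of `T k` is the weighted
transpose of that of `F k` (`inner_eq_of_hasSum_slice`). Normalising the nonzero `T k` by their
traces `p k` yields the `ρ k`.

Everything is done with the nuclear definition of the trace norm: estimates are made on a nearly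
optimal rank-one series, up to an arbitrary `ε`. -/

lemma summable_mul_of_sq_le {ι : Type*} {f g : ι → ℝ} {a b : ℝ} (hf : ∀ i, 0 ≤ f i)
    (hg : ∀ i, 0 ≤ g i) (ha : 0 ≤ a) (hb : 0 ≤ b)
    (hfa : ∀ s : Finset ι, ∑ i ∈ s, f i ^ 2 ≤ a ^ 2)
    (hgb : ∀ s : Finset ι, ∑ i ∈ s, g i ^ 2 ≤ b ^ 2) :
    Summable (fun i => f i * g i) ∧ ∑' i, f i * g i ≤ a * b := by
  have key : ∀ s : Finset ι, ∑ i ∈ s, f i * g i ≤ a * b := by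
    intro s
    refine le_of_sq_le_sq ?_ (mul_nonneg ha hb)
    calc (∑ i ∈ s, f i * g i) ^ 2 ≤ (∑ i ∈ s, f i ^ 2) * ∑ i ∈ s, g i ^ 2 :=
          Finset.sum_mul_sq_le_sq_mul_sq s f g
      _ ≤ a ^ 2 * b ^ 2 := mul_le_mul (hfa s) (hgb s) (by positivity) (by positivity)
      _ = (a * b) ^ 2 := by ring
  have hs := summable_of_sum_le (fun i => mul_nonneg (hf i) (hg i)) key
  exact ⟨hs, hs.tsum_le_of_sum_le key⟩

/-! ### Trace-class operators: completeness, trace, Kraus sums -/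

section TraceClassOperators

variable {H : Type u} [NormedAddCommGroup H] [InnerProductSpace ℂ H]
variable {K : Type v} [NormedAddCommGroup K] [InnerProductSpace ℂ K]

namespace TraceClass

@[simp] lemma toOp_rankOne (x y : H) :
    (rankOne x y).toOp = InnerProductSpace.rankOne ℂ x y := rfl

@[simp] lemma toOp_sub (A B : TraceClass H) : (A - B).toOp = A.toOp - B.toOp := by
  rw [sub_eq_add_neg, toOp_add, toOp_neg, sub_eq_add_neg]

lemma norm_rankOne_le (x y : H) : ‖rankOne x y‖ ≤ ‖x‖ * ‖y‖ :=
  csInf_le (bddBelow_traceNormSet _) (mem_rankOne x y)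

lemma norm_toOp_le (A : TraceClass H) : ‖A.toOp‖ ≤ ‖A‖ := norm_le_traceNorm A.isTraceClass

variable (H) in
/-- The inclusion of the trace-class operators into the bounded operators. -/
noncomputable def toOpL : TraceClass H →L[ℂ] (H →L[ℂ] H) :=
  (toOpₗ H).mkContinuous 1 fun A => by rw [one_mul]; exact norm_toOp_le A

@[simp] lemma toOpL_apply (A : TraceClass H) : toOpL H A = A.toOp := rfl

lemma hasSum_toOp {ι : Type*} {A : ι → TraceClass H} {B : TraceClass H} (h : HasSum A B) :
    HasSum (fun i => (A i).toOp) B.toOp := h.mapL (toOpL H)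

lemma hasSum_inner {ι : Type*} {A : ι → TraceClass H} {B : TraceClass H} (h : HasSum A B)
    (x y : H) : HasSum (fun i => ⟪x, (A i).toOp y⟫_ℂ) ⟪x, B.toOp y⟫_ℂ :=
  hasSum_inner_apply (hasSum_toOp h) x y

lemma exists_isRankOneSeries (A : TraceClass H) {ε : ℝ} (hε : 0 < ε) :
    ∃ x y : ℕ → H, IsRankOneSeries x y A.toOp ∧ ∑' n, ‖x n‖ * ‖y n‖ ≤ ‖A‖ + ε := by
  obtain ⟨c, ⟨x, y, h, rfl⟩, hc⟩ := Real.lt_sInf_add_pos A.isTraceClass.nonempty hε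
  exact ⟨x, y, h, hc.le⟩

lemma norm_le_of_isRankOneSeries {ι : Type*} (f : ℕ ≃ ι) {x y : ι → H} {A : TraceClass H}
    (h : IsRankOneSeries x y A.toOp) : ‖A‖ ≤ ∑' i, ‖x i‖ * ‖y i‖ :=
  csInf_le (bddBelow_traceNormSet _) (h.mem f)

/-- Nearly optimal rank-one series of the `A n`, with errors `δ n` of total at most `ε`, concatenate
to one rank-one series for `B`. The norm bound is what controls tails in the completeness proof. -/
lemma exists_toOp_eq_of_hasSum [CompleteSpace H] {A : ℕ → TraceClass H} {B : H →L[ℂ] H}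
    (hA : Summable fun n => ‖A n‖) (hB : HasSum (fun n => (A n).toOp) B) :
    ∃ T : TraceClass H, T.toOp = B ∧ ‖T‖ ≤ ∑' n, ‖A n‖ := by
  -- The norm bound is quantified over every `T` lying over `B` because the same argument is still
  -- producing the first such `T`.
  have key : ∀ ε : ℝ, 0 < ε → ∑' n, ‖A n‖ + ε ∈ upperBounds
      {c : ℝ | ∃ T : TraceClass H, T.toOp = B ∧ c = ‖T‖} ∧ IsTraceClass B := by
    intro ε hε
    obtain ⟨δ, hδ, c, hδc, hc⟩ := posSumOfEncodable hε ℕ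
    choose x y hxy hle using fun n => exists_isRankOneSeries (A n) (hδ n)
    have hs : Summable fun p : ℕ × ℕ => ‖x p.1 p.2‖ * ‖y p.1 p.2‖ := by
      rw [summable_prod_of_nonneg (fun p => by positivity)]
      refine ⟨fun n => (hxy n).1, ?_⟩
      exact Summable.of_nonneg_of_le (fun n => tsum_nonneg fun m => by positivity) hle
        (hA.add hδc.summable)
    have hsum : ∑' p : ℕ × ℕ, ‖x p.1 p.2‖ * ‖y p.1 p.2‖ ≤ ∑' n, ‖A n‖ + ε := by
      rw [hs.tsum_prod]
      calc ∑' n, ∑' m, ‖x n m‖ * ‖y n m‖ ≤ ∑' n, (‖A n‖ + δ n) :=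
            hs.prod.tsum_le_tsum hle (hA.add hδc.summable)
        _ = ∑' n, ‖A n‖ + c := by rw [hA.tsum_add hδc.summable, hδc.tsum_eq]
        _ ≤ _ := by gcongr
    have hs' : Summable fun p : ℕ × ℕ => InnerProductSpace.rankOne ℂ (x p.1 p.2) (y p.1 p.2) :=
      Summable.of_norm (hs.congr fun p => by rw [InnerProductSpace.norm_rankOne])
    have hBS : HasSum (fun p : ℕ × ℕ => InnerProductSpace.rankOne ℂ (x p.1 p.2) (y p.1 p.2)) B := by
      have h1 := hs'.hasSum.prod_fiberwise fun n => (hxy n).2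
      rw [hB.unique h1]
      exact hs'.hasSum
    have hser : IsRankOneSeries (fun p : ℕ × ℕ => x p.1 p.2) (fun p : ℕ × ℕ => y p.1 p.2) B :=
      ⟨hs, hBS⟩
    refine ⟨?_, isTraceClass_of_mem (hser.mem Nat.pairEquiv.symm)⟩
    rintro _ ⟨T, rfl, rfl⟩
    exact (norm_le_of_isRankOneSeries Nat.pairEquiv.symm hser).trans hsum
  refine ⟨⟨B, (key 1 one_pos).2⟩, rfl, le_of_forall_pos_le_add fun ε hε => ?_⟩
  exact (key ε hε).1 ⟨_, rfl, rfl⟩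

/-- An absolutely summable series converges in operator norm; its limit is trace-class, and the
preceding bound applied to the tails upgrades the convergence to trace norm. -/
instance [CompleteSpace H] : CompleteSpace (TraceClass H) := by
  refine NormedAddCommGroup.completeSpace_of_summable_imp_tendsto fun A hA => ?_
  have hs : Summable fun n => (A n).toOp :=
    Summable.of_norm_bounded hA fun n => norm_toOp_le _
  obtain ⟨T, hT, -⟩ := exists_toOp_eq_of_hasSum hA hs.hasSum
  refine ⟨T, ?_⟩
  rw [tendsto_iff_norm_sub_tendsto_zero]
  have hlim := tendsto_sum_nat_add fun n => ‖A n‖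
  refine squeeze_zero (fun _ => norm_nonneg _) (fun N => ?_) hlim
  have h1 := (hasSum_nat_add_iff' N).mpr hs.hasSum
  obtain ⟨S, hS, hle⟩ := exists_toOp_eq_of_hasSum ((summable_nat_add_iff N).mpr hA) h1
  have hST : S = T - ∑ n ∈ Finset.range N, A n := by
    apply toOp_injective
    rw [hS, toOp_sub, hT]
    congr 1
    exact (map_sum (toOpL H) A _).symm
  rw [norm_sub_rev, ← hST]
  exact hle

lemma summable_rankOne [CompleteSpace H] {ι : Type*} {x y : ι → H}
    (h : Summable fun i => ‖x i‖ * ‖y i‖) : Summable fun i => rankOne (x i) (y i) :=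
  Summable.of_norm_bounded h fun _ => norm_rankOne_le _ _

lemma hasSum_rankOne [CompleteSpace H] {ι : Type*} {x y : ι → H} {A : TraceClass H}
    (h : IsRankOneSeries x y A.toOp) : HasSum (fun i => rankOne (x i) (y i)) A := by
  have hs := summable_rankOne h.1
  have : ∑' i, rankOne (x i) (y i) = A := toOp_injective ((hasSum_toOp hs.hasSum).unique h.2)
  rw [← this]
  exact hs.hasSum

lemma exists_hasSum_rankOne [CompleteSpace H] (A : TraceClass H) {ε : ℝ} (hε : 0 < ε) :
    ∃ x y : ℕ → H, (Summable fun n => ‖x n‖ * ‖y n‖) ∧ ∑' n, ‖x n‖ * ‖y n‖ ≤ ‖A‖ + ε ∧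
      HasSum (fun n => rankOne (x n) (y n)) A := by
  obtain ⟨x, y, h, hle⟩ := exists_isRankOneSeries A hε
  exact ⟨x, y, h.1, hle, hasSum_rankOne h⟩

/-- Continuous linear maps on trace-class operators are determined by rank-one operators. -/
lemma clm_ext [CompleteSpace H] {E : Type*} [NormedAddCommGroup E] [NormedSpace ℂ E]
    {S T : TraceClass H →L[ℂ] E} (h : ∀ x y, S (rankOne x y) = T (rankOne x y)) : S = T := by
  ext A
  obtain ⟨x, y, -, -, hA⟩ := exists_hasSum_rankOne A one_pos
  refine (hA.mapL S).unique ?_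
  simpa only [h] using hA.mapL T

lemma rankOne_add_left (x x' y : H) : rankOne (x + x') y = rankOne x y + rankOne x' y := by
  apply toOp_injective; simp

lemma rankOne_add_right (x y y' : H) : rankOne x (y + y') = rankOne x y + rankOne x y' := by
  apply toOp_injective; simp

lemma rankOne_smul_left (c : ℂ) (x y : H) : rankOne (c • x) y = c • rankOne x y := by
  apply toOp_injective; simp

lemma rankOne_smul_right (c : ℂ) (x y : H) :
    rankOne x (c • y) = (starRingEnd ℂ c) • rankOne x y := by
  apply toOp_injective; simp

/-- All four vectors are written as `x + c • y`, so that a single estimate for `‖c‖ = 1` covers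
them. -/
lemma rankOne_polarization (x y : H) :
    rankOne x y = (1 / 4 : ℂ) • (rankOne (x + (1 : ℂ) • y) (x + (1 : ℂ) • y) -
      rankOne (x + (-1 : ℂ) • y) (x + (-1 : ℂ) • y) +
      Complex.I • rankOne (x + Complex.I • y) (x + Complex.I • y) -
      Complex.I • rankOne (x + (-Complex.I) • y) (x + (-Complex.I) • y)) := by
  simp only [rankOne_add_left, rankOne_add_right, rankOne_smul_left, rankOne_smul_right, map_neg,
    map_one, Complex.conj_I]
  match_scalars <;> ring_nf <;> norm_num [Complex.I_sq]

lemma rankOne_zero_left (y : H) : rankOne 0 y = 0 := by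
  apply toOp_injective; simp

lemma rankOne_zero_right (x : H) : rankOne x 0 = 0 := by
  apply toOp_injective; simp

lemma rankOne_sum_left {ι : Type*} (s : Finset ι) (x : ι → H) (y : H) :
    rankOne (∑ i ∈ s, x i) y = ∑ i ∈ s, rankOne (x i) y :=
  map_sum (AddMonoidHom.mk' (fun x => rankOne x y) fun a b => rankOne_add_left a b y) x s

lemma rankOne_sum_right {ι : Type*} (s : Finset ι) (x : H) (y : ι → H) :
    rankOne x (∑ i ∈ s, y i) = ∑ i ∈ s, rankOne x (y i) :=
  map_sum (AddMonoidHom.mk' (fun y => rankOne x y) fun a b => rankOne_add_right x a b) y s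

lemma tendsto_rankOne {α : Type*} {f : Filter α} {x y : α → H} {x₀ y₀ : H}
    (hx : Tendsto x f (𝓝 x₀)) (hy : Tendsto y f (𝓝 y₀)) :
    Tendsto (fun t => rankOne (x t) (y t)) f (𝓝 (rankOne x₀ y₀)) := by
  rw [tendsto_iff_norm_sub_tendsto_zero]
  have hlim : Tendsto (fun t => ‖x t - x₀‖ * ‖y t‖ + ‖x₀‖ * ‖y t - y₀‖) f (𝓝 0) := by
    simpa using ((hx.sub_const x₀).norm.mul hy.norm).add ((hy.sub_const y₀).norm.const_mul ‖x₀‖)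
  refine squeeze_zero (fun _ => norm_nonneg _) (fun t => ?_) hlim
  have : rankOne (x t) (y t) - rankOne x₀ y₀ =
      rankOne (x t - x₀) (y t) + rankOne x₀ (y t - y₀) := by
    apply toOp_injective; simp
  rw [this]
  exact (norm_add_le _ _).trans (add_le_add (norm_rankOne_le _ _) (norm_rankOne_le _ _))

lemma continuous_rankOne_left (y : H) : Continuous fun x : H => rankOne x y :=
  continuous_iff_continuousAt.mpr fun _ => tendsto_rankOne tendsto_id tendsto_const_nhds

lemma continuous_rankOne_right (x : H) : Continuous fun y : H => rankOne x y :=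
  continuous_iff_continuousAt.mpr fun _ => tendsto_rankOne tendsto_const_nhds tendsto_id

/-! ### The trace -/

/-- The double series `⟪b i, x n⟫ ⟪y n, b i⟫` converges absolutely by Cauchy–Schwarz and Bessel.
Summing over `i` first gives `⟪y n, x n⟫` by Parseval, over `n` first the diagonal entries of `A`.
The value does not mention `b`, whence basis independence of the trace. -/
lemma hasSum_inner_basis [CompleteSpace H] {ι : Type*} (b : HilbertBasis ι ℂ H) {x y : ℕ → H}
    {A : H →L[ℂ] H} (h : IsRankOneSeries x y A) :
    HasSum (fun i => ⟪b i, A (b i)⟫_ℂ) (∑' n, ⟪y n, x n⟫_ℂ) := by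
  have hb : ∀ (z : H) (s : Finset ι), ∑ i ∈ s, ‖⟪b i, z⟫_ℂ‖ ^ 2 ≤ ‖z‖ ^ 2 :=
    fun z s => b.orthonormal.sum_inner_products_le z
  have hcs : ∀ n, Summable (fun i => ‖⟪b i, x n⟫_ℂ‖ * ‖⟪b i, y n⟫_ℂ‖) ∧
      ∑' i, ‖⟪b i, x n⟫_ℂ‖ * ‖⟪b i, y n⟫_ℂ‖ ≤ ‖x n‖ * ‖y n‖ := fun n =>
    summable_mul_of_sq_le (fun i => norm_nonneg _) (fun i => norm_nonneg _) (norm_nonneg _)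
      (norm_nonneg _) (hb _) (hb _)
  have hs : Summable fun p : ℕ × ι => ‖⟪b p.2, x p.1⟫_ℂ‖ * ‖⟪b p.2, y p.1⟫_ℂ‖ := by
    rw [summable_prod_of_nonneg (fun p => by positivity)]
    exact ⟨fun n => (hcs n).1, Summable.of_nonneg_of_le
      (fun n => tsum_nonneg fun m => by positivity) (fun n => (hcs n).2) h.1⟩
  have hs' : Summable fun p : ℕ × ι => ⟪b p.2, x p.1⟫_ℂ * ⟪y p.1, b p.2⟫_ℂ :=
    Summable.of_norm (hs.congr fun p => by rw [norm_mul, norm_inner_symm (y _)])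
  have h1 := hs'.hasSum.prod_fiberwise (g := fun n => ⟪y n, x n⟫_ℂ) fun n => by
    simpa only [mul_comm] using b.hasSum_inner_mul_inner (y n) (x n)
  rw [h1.tsum_eq]
  have h2 := (Equiv.prodComm ι ℕ).hasSum_iff.mpr hs'.hasSum
  exact h2.prod_fiberwise (fun i => hasSum_inner_rankOne h.2 (b i) (b i))

variable [CompleteSpace H] [CompleteSpace K]

lemma trace_eq_tsum {x y : ℕ → H} {A : H →L[ℂ] H} (h : IsRankOneSeries x y A) :
    trace A = ∑' n, ⟪y n, x n⟫_ℂ := (hasSum_inner_basis _ h).tsum_eq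

lemma hasSum_trace {ι : Type*} (b : HilbertBasis ι ℂ H) (A : TraceClass H) :
    HasSum (fun i => ⟪b i, A.toOp (b i)⟫_ℂ) (trace A.toOp) := by
  obtain ⟨x, y, h⟩ := A.isTraceClass
  rw [trace_eq_tsum h]
  exact hasSum_inner_basis b h

variable (H) in
/-- The trace as a continuous linear functional on the trace-class operators. -/
noncomputable def traceL : TraceClass H →L[ℂ] ℂ :=
  LinearMap.mkContinuous
    { toFun := fun A => trace A.toOp
      map_add' := fun A B => by
        have b := (exists_hilbertBasis ℂ H).choose_spec.choose
        refine (hasSum_trace b (A + B)).unique ?_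
        simpa [inner_add_right] using (hasSum_trace b A).add (hasSum_trace b B)
      map_smul' := fun c A => by
        have b := (exists_hilbertBasis ℂ H).choose_spec.choose
        refine (hasSum_trace b (c • A)).unique ?_
        simpa [inner_smul_right] using (hasSum_trace b A).mul_left c } 1 fun A => by
    refine le_of_forall_pos_le_add fun ε hε => ?_
    obtain ⟨x, y, h, hle⟩ := exists_isRankOneSeries A hε
    rw [one_mul, LinearMap.coe_mk, AddHom.coe_mk, trace_eq_tsum h]
    have hn : ∀ n, ‖⟪y n, x n⟫_ℂ‖ ≤ ‖x n‖ * ‖y n‖ := fun n =>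
      (norm_inner_le_norm _ _).trans_eq (mul_comm _ _)
    exact (tsum_of_norm_bounded h.1.hasSum hn).trans hle

@[simp] lemma traceL_apply (A : TraceClass H) : traceL H A = trace A.toOp := rfl

lemma trace_rankOne (x y : H) : trace (rankOne x y).toOp = ⟪y, x⟫_ℂ := by
  have b := (exists_hilbertBasis ℂ H).choose_spec.choose
  refine (hasSum_trace b (rankOne x y)).unique ?_
  simpa [mul_comm, inner_smul_right] using b.hasSum_inner_mul_inner y x

lemma hasSum_trace_of_hasSum {ι : Type*} {A : ι → TraceClass H} {B : TraceClass H}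
    (h : HasSum A B) : HasSum (fun i => trace (A i).toOp) (trace B.toOp) := h.mapL (traceL H)

/-! ### The maps `A ↦ S A T^*` and sums of such maps -/

lemma isRankOneSeries_sandwich (S T : H →L[ℂ] K) {ι : Type*} {x y : ι → H} {A : H →L[ℂ] H}
    (h : IsRankOneSeries x y A) :
    IsRankOneSeries (fun n => S (x n)) (fun n => T (y n)) (S ∘L A ∘L T.adjoint) := by
  refine ⟨?_, ?_⟩
  · refine Summable.of_nonneg_of_le (fun n => by positivity) (fun n => ?_)
      (h.1.mul_left (‖S‖ * ‖T‖))
    calc ‖S (x n)‖ * ‖T (y n)‖ ≤ (‖S‖ * ‖x n‖) * (‖T‖ * ‖y n‖) := by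
          gcongr <;> exact ContinuousLinearMap.le_opNorm _ _
      _ = ‖S‖ * ‖T‖ * (‖x n‖ * ‖y n‖) := by ring
  · have h1 := (h.2.mapL ((ContinuousLinearMap.compL ℂ K H H).flip T.adjoint)).mapL
      (ContinuousLinearMap.compL ℂ K H K S)
    refine h1.congr_fun fun n => ?_
    ext z
    simp [ContinuousLinearMap.adjoint_inner_right]

/-- The map `A ↦ S A T^*` on trace-class operators. -/
noncomputable def sandwich (S T : H →L[ℂ] K) : TraceClass H →L[ℂ] TraceClass K :=
  LinearMap.mkContinuous
    { toFun := fun A => ⟨S ∘L A.toOp ∘L T.adjoint, by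
        obtain ⟨x, y, h⟩ := A.isTraceClass
        exact ⟨_, _, isRankOneSeries_sandwich S T h⟩⟩
      map_add' := fun A B => toOp_injective (by
        ext z
        exact map_add S _ _)
      map_smul' := fun c A => toOp_injective (by
        ext z
        exact map_smul S _ _) } (‖S‖ * ‖T‖) fun A => by
    rw [mul_comm]
    refine le_of_forall_pos_le_add fun ε hε => ?_
    obtain ⟨δ, hδ, hδε⟩ : ∃ δ : ℝ, 0 < δ ∧ (‖S‖ * ‖T‖) * δ ≤ ε := by
      -- The `+ 1` keeps the denominator positive when `S` or `T` vanishes.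
      refine ⟨ε / (‖S‖ * ‖T‖ + 1), by positivity, ?_⟩
      rw [mul_div_assoc', div_le_iff₀ (by positivity)]
      nlinarith [norm_nonneg S, norm_nonneg T]
    obtain ⟨x, y, h, hle⟩ := exists_isRankOneSeries A hδ
    have h' := isRankOneSeries_sandwich S T h
    refine (norm_le_of_isRankOneSeries (Equiv.refl ℕ) h').trans ?_
    calc ∑' n, ‖S (x n)‖ * ‖T (y n)‖ ≤ ∑' n, (‖S‖ * ‖T‖) * (‖x n‖ * ‖y n‖) := by
          refine h'.1.tsum_le_tsum (fun n => ?_) (h.1.mul_left _)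
          calc ‖S (x n)‖ * ‖T (y n)‖ ≤ (‖S‖ * ‖x n‖) * (‖T‖ * ‖y n‖) := by
                gcongr <;> exact ContinuousLinearMap.le_opNorm _ _
            _ = ‖S‖ * ‖T‖ * (‖x n‖ * ‖y n‖) := by ring
      _ = (‖S‖ * ‖T‖) * ∑' n, ‖x n‖ * ‖y n‖ := tsum_mul_left
      _ ≤ (‖S‖ * ‖T‖) * (‖A‖ + δ) := by gcongr
      _ ≤ _ := by rw [mul_add, mul_comm ‖A‖]; gcongr

lemma toOp_sandwich (S T : H →L[ℂ] K) (A : TraceClass H) :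
    (sandwich S T A).toOp = S ∘L A.toOp ∘L T.adjoint := rfl

@[simp] lemma sandwich_rankOne (S T : H →L[ℂ] K) (x y : H) :
    sandwich S T (rankOne x y) = rankOne (S x) (T y) := by
  apply toOp_injective
  rw [toOp_sandwich]
  ext z
  simp [ContinuousLinearMap.adjoint_inner_right]

section Kraus

variable {J : Type*} {L : J → H →L[ℂ] K}

/-- The hypothesis is the weak form of `∑ (L j)^* L j ≤ I`. Cauchy–Schwarz in `j` bounds the
contribution of one rank-one term by `‖x‖ ‖y‖`, and the sums over `j` and over the rank-one series
are then exchanged. -/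
lemma summable_norm_kraus
    (hL : ∀ (x : H) (s : Finset J), ∑ j ∈ s, ‖L j x‖ ^ 2 ≤ ‖x‖ ^ 2) (A : TraceClass H) :
    Summable (fun j => ‖sandwich (L j) (L j) A‖) ∧
      ∑' j, ‖sandwich (L j) (L j) A‖ ≤ ‖A‖ := by
  have hcs : ∀ x y : H, Summable (fun j => ‖L j x‖ * ‖L j y‖) ∧
      ∑' j, ‖L j x‖ * ‖L j y‖ ≤ ‖x‖ * ‖y‖ := fun x y =>
    summable_mul_of_sq_le (fun i => norm_nonneg _) (fun i => norm_nonneg _) (norm_nonneg _)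
      (norm_nonneg _) (hL x) (hL y)
  have key : ∀ ε : ℝ, 0 < ε → Summable (fun j => ‖sandwich (L j) (L j) A‖) ∧
      ∑' j, ‖sandwich (L j) (L j) A‖ ≤ ‖A‖ + ε := by
    intro ε hε
    obtain ⟨x, y, h, hle⟩ := exists_isRankOneSeries A hε
    have hs : Summable fun p : ℕ × J => ‖L p.2 (x p.1)‖ * ‖L p.2 (y p.1)‖ := by
      rw [summable_prod_of_nonneg (fun p => by positivity)]
      exact ⟨fun n => (hcs (x n) (y n)).1, Summable.of_nonneg_of_le
        (fun n => tsum_nonneg fun m => by positivity) (fun n => (hcs (x n) (y n)).2) h.1⟩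
    have hsum : ∑' p : ℕ × J, ‖L p.2 (x p.1)‖ * ‖L p.2 (y p.1)‖ ≤ ‖A‖ + ε := by
      rw [hs.tsum_prod]
      exact (hs.prod.tsum_le_tsum (fun n => (hcs (x n) (y n)).2) h.1).trans hle
    have hs2 : Summable fun p : J × ℕ => ‖L p.1 (x p.2)‖ * ‖L p.1 (y p.2)‖ :=
      (Equiv.prodComm J ℕ).summable_iff.mpr hs
    have hsum2 : ∑' p : J × ℕ, ‖L p.1 (x p.2)‖ * ‖L p.1 (y p.2)‖ ≤ ‖A‖ + ε :=
      ((Equiv.prodComm J ℕ).tsum_eq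
        (fun p : ℕ × J => ‖L p.2 (x p.1)‖ * ‖L p.2 (y p.1)‖)).trans_le hsum
    have hle' : ∀ j, ‖sandwich (L j) (L j) A‖ ≤ ∑' n, ‖L j (x n)‖ * ‖L j (y n)‖ := fun j =>
      norm_le_of_isRankOneSeries (Equiv.refl ℕ) (isRankOneSeries_sandwich (L j) (L j) h)
    have hs3 := Summable.of_nonneg_of_le (fun j => norm_nonneg _) hle' hs2.prod
    refine ⟨hs3, (hs3.tsum_le_tsum hle' hs2.prod).trans ?_⟩
    rw [← hs2.tsum_prod]
    exact hsum2
  exact ⟨(key 1 one_pos).1, le_of_forall_pos_le_add fun ε hε => (key ε hε).2⟩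

/-- The map `A ↦ ∑ j, L j A (L j)^*`. -/
noncomputable def kraus (L : J → H →L[ℂ] K)
    (hL : ∀ (x : H) (s : Finset J), ∑ j ∈ s, ‖L j x‖ ^ 2 ≤ ‖x‖ ^ 2) :
    TraceClass H →L[ℂ] TraceClass K :=
  LinearMap.mkContinuous
    { toFun := fun A => ∑' j, sandwich (L j) (L j) A
      map_add' := fun A B => by
        simp only [map_add]
        exact (summable_norm_kraus hL A).1.of_norm.tsum_add (summable_norm_kraus hL B).1.of_norm
      map_smul' := fun c A => by
        simp only [map_smul, RingHom.id_apply]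
        exact (summable_norm_kraus hL A).1.of_norm.tsum_const_smul c } 1 fun A => by
    rw [one_mul]
    exact (norm_tsum_le_tsum_norm (summable_norm_kraus hL A).1).trans (summable_norm_kraus hL A).2

lemma hasSum_kraus (hL : ∀ (x : H) (s : Finset J), ∑ j ∈ s, ‖L j x‖ ^ 2 ≤ ‖x‖ ^ 2)
    (A : TraceClass H) : HasSum (fun j => sandwich (L j) (L j) A) (kraus L hL A) :=
  (summable_norm_kraus hL A).1.of_norm.hasSum

end Kraus

end TraceClass

end TraceClassOperators

/-! ### Positive trace-class operators -/

section Positive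

variable {H : Type u} [NormedAddCommGroup H] [InnerProductSpace ℂ H]

lemma isPositive_of_inner_nonneg {A : H →L[ℂ] H} (h : ∀ x, 0 ≤ ⟪x, A x⟫_ℂ) : A.IsPositive := by
  rw [ContinuousLinearMap.isPositive_iff_complex]
  intro x
  have h1 := h x
  rw [Complex.le_def] at h1
  rw [← inner_conj_symm (A x) x]
  refine ⟨?_, by rw [RCLike.conj_re]; exact h1.1⟩
  apply Complex.ext
  · rfl
  · rw [Complex.conj_im, ← h1.2]
    simp

namespace TraceClass

lemma isPositive_of_hasSum {ι : Type*} {A : ι → TraceClass H} {B : TraceClass H}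
    (h : HasSum A B) (hA : ∀ i, (A i).toOp.IsPositive) : B.toOp.IsPositive :=
  isPositive_of_inner_nonneg fun x => (hasSum_inner h x x).nonneg fun i =>
    (hA i).inner_nonneg_right x

lemma isPositive_rankOne_self (z : H) : (rankOne z z).toOp.IsPositive :=
  InnerProductSpace.isPositive_rankOne_self z

end TraceClass

variable [CompleteSpace H]

/-- A positive operator `F` is the weakly convergent sum `∑ m, a m (a m)^*`, where `a m` is the
image of the basis vector `b m` under the square root of `F`. -/
lemma exists_frame_of_isPositive {ι : Type*} (b : HilbertBasis ι ℂ H) {F : H →L[ℂ] H}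
    (hF : F.IsPositive) :
    ∃ a : ι → H, (∀ x y, HasSum (fun m => ⟪x, a m⟫_ℂ * ⟪a m, y⟫_ℂ) ⟪x, F y⟫_ℂ) ∧
      ∀ m, ⟪a m, a m⟫_ℂ = ⟪b m, F (b m)⟫_ℂ := by
  have hF0 : 0 ≤ F := (ContinuousLinearMap.nonneg_iff_isPositive F).mpr hF
  set S := CFC.sqrt F with hS
  have hSS : S * S = F := CFC.sqrt_mul_sqrt_self F hF0
  have hSsym : ∀ x y, ⟪S x, y⟫_ℂ = ⟪x, S y⟫_ℂ :=
    ((ContinuousLinearMap.nonneg_iff_isPositive S).mp (CFC.sqrt_nonneg F)).isSymmetric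
  have hF' : ∀ y, F y = S (S y) := fun y => by rw [← hSS]; rfl
  refine ⟨fun m => S (b m), fun x y => ?_, fun m => ?_⟩
  · have := b.hasSum_inner_mul_inner (S x) (S y)
    rw [hSsym, ← hF'] at this
    refine this.congr_fun fun m => ?_
    rw [hSsym (b m) y, ← hSsym x]
  · rw [hSsym, ← hF']

namespace TraceClass

lemma hasSum_norm_sq {ι : Type*} {z : ι → H} {A : TraceClass H}
    (h : HasSum (fun i => rankOne (z i) (z i)) A) :
    HasSum (fun i => ‖z i‖ ^ 2) (trace A.toOp).re := by
  have h1 := (hasSum_trace_of_hasSum h).mapL Complex.reCLM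
  refine h1.congr_fun fun i => ?_
  rw [trace_rankOne, inner_self_eq_norm_sq_to_K]
  simp [← Complex.ofReal_pow]

/-- With `z i` the images of the basis under the square root of `A`, the squares `‖z i‖ ^ 2` sum to
the trace of `A`, so the weak expansion converges in trace norm. -/
lemma exists_hasSum_rankOne_self {ι : Type*} (b : HilbertBasis ι ℂ H) {A : TraceClass H}
    (hA : A.toOp.IsPositive) :
    ∃ z : ι → H, (Summable fun i => ‖z i‖ ^ 2) ∧ HasSum (fun i => rankOne (z i) (z i)) A := by
  obtain ⟨z, hz, hzb⟩ := exists_frame_of_isPositive b hA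
  have hs : Summable fun i => ‖z i‖ ^ 2 := by
    have h1 := (hasSum_trace b A).mapL Complex.reCLM
    refine h1.summable.congr fun i => ?_
    rw [← hzb, inner_self_eq_norm_sq_to_K]
    simp [← Complex.ofReal_pow]
  refine ⟨z, hs, ?_⟩
  have hs' := summable_rankOne (x := z) (y := z) (hs.congr fun i => by ring)
  have : ∑' i, rankOne (z i) (z i) = A := by
    apply toOp_injective
    ext1 y
    refine ext_inner_left ℂ fun x => ?_
    refine (hasSum_inner hs'.hasSum x y).unique ((hz x y).congr_fun fun i => ?_)
    simp [mul_comm]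
  rw [← this]
  exact hs'.hasSum

lemma norm_le_trace_of_isPositive {A : TraceClass H} (hA : A.toOp.IsPositive) :
    ‖A‖ ≤ (trace A.toOp).re := by
  obtain ⟨z, hs, hz⟩ :=
    exists_hasSum_rankOne_self (exists_hilbertBasis ℂ H).choose_spec.choose hA
  rw [← (hasSum_norm_sq hz).tsum_eq, ← hz.tsum_eq]
  refine tsum_of_norm_bounded hs.hasSum fun i => ?_
  rw [sq]
  exact norm_rankOne_le _ _

lemma exists_balanced (x y : H) : ∃ x' y' : H, rankOne x' y' = rankOne x y ∧
    ‖x'‖ ^ 2 = ‖x‖ * ‖y‖ ∧ ‖y'‖ ^ 2 = ‖x‖ * ‖y‖ := by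
  rcases eq_or_ne x 0 with rfl | hx
  · exact ⟨0, 0, by simp [rankOne_zero_left], by simp, by simp⟩
  rcases eq_or_ne y 0 with rfl | hy
  · exact ⟨0, 0, by apply toOp_injective; simp, by simp, by simp⟩
  have hx' : 0 < ‖x‖ := norm_pos_iff.mpr hx
  have hy' : 0 < ‖y‖ := norm_pos_iff.mpr hy
  set t : ℝ := √(‖y‖ / ‖x‖) with ht
  have ht0 : 0 < t := Real.sqrt_pos.mpr (by positivity)
  have ht2 : t ^ 2 = ‖y‖ / ‖x‖ := Real.sq_sqrt (by positivity)
  refine ⟨(t : ℂ) • x, ((t⁻¹ : ℝ) : ℂ) • y, ?_, ?_, ?_⟩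
  · rw [rankOne_smul_left, rankOne_smul_right, smul_smul, Complex.conj_ofReal,
      ← Complex.ofReal_mul, mul_inv_cancel₀ ht0.ne', Complex.ofReal_one, one_smul]
  · rw [norm_smul, Complex.norm_real, Real.norm_of_nonneg ht0.le, mul_pow, ht2]
    field_simp
  · rw [norm_smul, Complex.norm_real, Real.norm_of_nonneg (by positivity), mul_pow, inv_pow, ht2]
    field_simp

/-- Every trace-class operator is a combination of four positive ones of controlled trace. -/
lemma exists_positive_decomposition (A : TraceClass H) {ε : ℝ} (hε : 0 < ε) :
    ∃ P : ℂ → TraceClass H, (∀ c, (P c).toOp.IsPositive) ∧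
      (∀ c, ‖c‖ = 1 → (trace (P c).toOp).re ≤ 4 * (‖A‖ + ε)) ∧
      A = (1 / 4 : ℂ) • (P 1 - P (-1) + Complex.I • P Complex.I - Complex.I • P (-Complex.I)) := by
  obtain ⟨x₀, y₀, hs₀, hle, hA₀⟩ := exists_hasSum_rankOne A hε
  choose x y hxy hx hy using fun n => exists_balanced (x₀ n) (y₀ n)
  have hA : HasSum (fun n => rankOne (x n) (y n)) A := by simpa only [hxy] using hA₀
  have hbound : ∀ (c : ℂ), ‖c‖ = 1 → ∀ n, ‖x n + c • y n‖ ^ 2 ≤ 4 * (‖x₀ n‖ * ‖y₀ n‖) := by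
    intro c hc n
    have h1 : ‖x n + c • y n‖ ≤ ‖x n‖ + ‖y n‖ := by
      simpa [norm_smul, hc] using norm_add_le (x n) (c • y n)
    have h2 : ‖x n + c • y n‖ ^ 2 ≤ (‖x n‖ + ‖y n‖) ^ 2 := by gcongr
    nlinarith [hx n, hy n, sq_nonneg (‖x n‖ - ‖y n‖)]
  have hsq : ∀ (c : ℂ), ‖c‖ = 1 → Summable fun n => ‖x n + c • y n‖ ^ 2 := fun c hc =>
    Summable.of_nonneg_of_le (fun n => by positivity) (hbound c hc) (hs₀.mul_left 4)
  have hP : ∀ (c : ℂ), ‖c‖ = 1 → HasSum (fun n => rankOne (x n + c • y n) (x n + c • y n))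
      (∑' n, rankOne (x n + c • y n) (x n + c • y n)) := fun c hc =>
    (summable_rankOne ((hsq c hc).congr fun n => by ring)).hasSum
  have hI := Complex.norm_I
  refine ⟨fun c => ∑' n, rankOne (x n + c • y n) (x n + c • y n), fun c => ?_,
    fun c hc => ?_, ?_⟩
  -- Positivity is required for every `c`, while summability is at hand only for `‖c‖ = 1`;
  -- otherwise `tsum` may take its default value `0`, which is positive.
  · by_cases hs : Summable fun n => rankOne (x n + c • y n) (x n + c • y n)
    · exact isPositive_of_hasSum hs.hasSum fun n => isPositive_rankOne_self _
    · simp only [tsum_eq_zero_of_not_summable hs]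
      exact ContinuousLinearMap.isPositive_zero
  · rw [← (hasSum_norm_sq (hP c hc)).tsum_eq]
    calc ∑' n, ‖x n + c • y n‖ ^ 2 ≤ ∑' n, 4 * (‖x₀ n‖ * ‖y₀ n‖) :=
          (hsq c hc).tsum_le_tsum (hbound c hc) (hs₀.mul_left 4)
      _ = 4 * ∑' n, ‖x₀ n‖ * ‖y₀ n‖ := tsum_mul_left
      _ ≤ _ := by gcongr
  · have h1 := ((((hP 1 (by simp)).sub (hP (-1) (by simp))).add
      ((hP Complex.I hI).const_smul Complex.I)).sub
      ((hP (-Complex.I) (by simp)).const_smul Complex.I)).const_smul (1 / 4 : ℂ)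
    exact hA.unique (h1.congr_fun fun n => rankOne_polarization (x n) (y n))

end TraceClass

end Positive

/-! ### Automatic boundedness of channels -/

section Channel

variable {H : Type u} [NormedAddCommGroup H] [InnerProductSpace ℂ H] [CompleteSpace H]
variable {K : Type v} [NormedAddCommGroup K] [InnerProductSpace ℂ K] [CompleteSpace K]

namespace IsChannel

variable {Φ : TraceClass H →ₗ[ℂ] TraceClass K}

lemma isPositive_map (hΦ : IsChannel Φ) {A : TraceClass H} (hA : A.toOp.IsPositive) :
    (Φ A).toOp.IsPositive := by
  refine isPositive_of_inner_nonneg fun x => ?_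
  have := hΦ.completelyPositive 1 (fun _ _ => A)
    (fun x => by simpa using hA.inner_nonneg_right (x 0)) (fun _ => x)
  simpa using this

/-- On positive operators the trace norm is bounded by the trace, which `Φ` preserves. Polarisation
into four positive parts, each of trace at most `4 (‖A‖ + ε / 4)`, with prefactor `1 / 4`, produces
the constant `4`; only boundedness matters later. -/
lemma norm_map_le (hΦ : IsChannel Φ) (A : TraceClass H) : ‖Φ A‖ ≤ 4 * ‖A‖ := by
  refine le_of_forall_pos_le_add fun ε hε => ?_
  obtain ⟨P, hP, htr, hA⟩ := TraceClass.exists_positive_decomposition A (ε := ε / 4) (by positivity)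
  have hb : ∀ c, ‖c‖ = 1 → ‖Φ (P c)‖ ≤ 4 * (‖A‖ + ε / 4) := fun c hc => by
    refine (TraceClass.norm_le_trace_of_isPositive (hΦ.isPositive_map (hP c))).trans ?_
    rw [hΦ.tracePreserving]
    exact htr c hc
  have h1 := hb 1 (by simp)
  have h2 := hb (-1) (by simp)
  have h3 := hb Complex.I (by simp)
  have h4 := hb (-Complex.I) (by simp)
  have heq : Φ A = (1 / 4 : ℂ) • (Φ (P 1) - Φ (P (-1)) + Complex.I • Φ (P Complex.I) -
      Complex.I • Φ (P (-Complex.I))) := by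
    conv_lhs => rw [hA]
    simp only [map_smul, map_sub, map_add]
  rw [heq, norm_smul]
  have h5 := norm_sub_le (Φ (P 1) - Φ (P (-1)) + Complex.I • Φ (P Complex.I))
    (Complex.I • Φ (P (-Complex.I)))
  have h6 := norm_add_le (Φ (P 1) - Φ (P (-1))) (Complex.I • Φ (P Complex.I))
  have h7 := norm_sub_le (Φ (P 1)) (Φ (P (-1)))
  rw [norm_smul, Complex.norm_I, one_mul] at h5 h6
  have h8 : ‖(1 / 4 : ℂ)‖ = 1 / 4 := by simp
  rw [h8]
  linarith

end IsChannel

end Channel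

/-! ### Joint diagonalisation of commuting compact self-adjoint operators -/

section Spectral

variable {H : Type u} [NormedAddCommGroup H] [InnerProductSpace ℂ H]

lemma isCompactOperator_rankOne (x y : H) :
    IsCompactOperator (InnerProductSpace.rankOne ℂ x y : H →L[ℂ] H) := by
  have h : IsCompactOperator (innerSL ℂ y : H →L[ℂ] ℂ) :=
    isCompactOperator_of_locallyCompactSpace_dom _
  exact h.clm_comp (ContinuousLinearMap.toSpanSingleton ℂ x)

lemma IsTraceClass.isCompactOperator [CompleteSpace H] {A : H →L[ℂ] H} (hA : IsTraceClass A) :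
    IsCompactOperator A := by
  obtain ⟨x, y, -, h⟩ := hA
  refine isCompactOperator_of_tendsto h (Eventually.of_forall fun s => ?_)
  exact (compactOperator (RingHom.id ℂ) H H).sum_mem fun i _ => isCompactOperator_rankOne _ _

open Module.End

/-- A nonzero member of the family has a nonzero eigenvalue. Its eigenspace is finite-dimensional
and, by commutation, invariant under the whole family, so finite-dimensional simultaneous
diagonalisation applies there. -/
lemma exists_joint_eigenvector [CompleteSpace H] [Nontrivial H] {I : Type*} {T : I → H →L[ℂ] H}
    (hc : ∀ i, IsCompactOperator (T i)) (hs : ∀ i, (T i).IsSymmetric)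
    (hT : ∀ i j, T i * T j = T j * T i) :
    ∃ v : H, v ≠ 0 ∧ ∀ i, ∃ c : ℂ, T i v = c • v := by
  by_cases h0 : ∀ i, T i = 0
  · obtain ⟨v, hv⟩ := exists_ne (0 : H)
    exact ⟨v, hv, fun i => ⟨0, by simp [h0 i]⟩⟩
  push Not at h0
  obtain ⟨i₀, hi₀⟩ := h0
  have h1 := mt (ContinuousLinearMap.eq_zero_of_forall_hasEigenvalue_eq_zero (hc i₀) (hs i₀)).mp hi₀
  push Not at h1
  obtain ⟨μ, hμ, hμ0⟩ := h1
  have hfin := ContinuousLinearMap.finite_dimensional_eigenspace (hc i₀) μ hμ0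
  set V := eigenspace ((T i₀ : H →L[ℂ] H) : H →ₗ[ℂ] H) μ with hV
  have hmaps : ∀ i, ∀ v ∈ V, (T i : H →ₗ[ℂ] H) v ∈ V := by
    intro i v hv
    rw [hV, mem_eigenspace_iff] at hv ⊢
    have h2 : T i₀ (T i v) = T i (T i₀ v) := congr($(hT i₀ i) v)
    have h3 : T i₀ v = μ • v := hv
    change T i₀ (T i v) = μ • T i v
    rw [h2, h3, map_smul]
  have hsym : ∀ i, ((T i : H →ₗ[ℂ] H).restrict (hmaps i)).IsSymmetric := fun i =>
    LinearMap.IsSymmetric.restrict_invariant (hs i) (hmaps i)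
  have htop := LinearMap.IsSymmetric.iSup_iInf_eq_top_of_commute hsym (fun i j _ => by
    ext v
    exact congr($(hT i j) v))
  have hVnt : Nontrivial V := Submodule.nontrivial_iff_ne_bot.mpr hμ
  have : ∃ χ : I → ℂ, ⨅ i, eigenspace ((T i : H →ₗ[ℂ] H).restrict (hmaps i)) (χ i) ≠ ⊥ := by
    by_contra! hcon
    simp only [hcon, iSup_bot] at htop
    exact bot_ne_top htop
  obtain ⟨χ, hχ⟩ := this
  obtain ⟨v, hv, hv0⟩ := Submodule.exists_mem_ne_zero_of_ne_bot hχ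
  refine ⟨v, by simpa using hv0, fun i => ⟨χ i, ?_⟩⟩
  have h4 := (Submodule.mem_iInf _).mp hv i
  rw [mem_eigenspace_iff] at h4
  exact congr(($h4 : H))

/-- A commuting family of compact self-adjoint operators has a Hilbert basis of joint
eigenvectors. -/
lemma exists_hilbertBasis_joint_eigenvectors [CompleteSpace H] {I : Type*} {T : I → H →L[ℂ] H}
    (hc : ∀ i, IsCompactOperator (T i)) (hs : ∀ i, (T i).IsSymmetric)
    (hT : ∀ i j, T i * T j = T j * T i) :
    ∃ (s : Set H) (b : HilbertBasis s ℂ H), ∀ k i, ∃ c : ℂ, T i (b k) = c • b k := by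
  classical
  -- Take a maximal orthonormal set of joint eigenvectors. Its orthogonal complement is invariant,
  -- so if nonzero it contains another joint eigenvector, against maximality.
  obtain ⟨s, hmax⟩ := zorn_subset {s : Set H | Orthonormal ℂ ((↑) : s → H) ∧
      ∀ v ∈ s, ∀ i, ∃ c : ℂ, T i v = c • v} (fun C hC hchain => by
    refine ⟨⋃₀ C, ⟨orthonormal_sUnion_of_directed hchain.directedOn fun a ha => (hC ha).1, ?_⟩,
      fun a ha => Set.subset_sUnion_of_mem ha⟩
    rintro v ⟨a, ha, hva⟩
    exact (hC ha).2 v hva)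
  obtain ⟨hon, heig⟩ := hmax.prop
  set W := (Submodule.span ℂ s)ᗮ with hW
  have hmem : ∀ w, w ∈ W ↔ ∀ v ∈ s, ⟪v, w⟫_ℂ = 0 := by
    intro w
    refine ⟨fun hw v hv => hw v (Submodule.subset_span hv), fun hw v hv => ?_⟩
    induction hv using Submodule.span_induction with
    | mem v hv => exact hw v hv
    | zero => exact inner_zero_left _
    | add a b _ _ ha hb => rw [inner_add_left, ha, hb, add_zero]
    | smul c a _ ha => rw [inner_smul_left, ha, mul_zero]
  have hinv : ∀ i, ∀ w ∈ W, (T i : H →ₗ[ℂ] H) w ∈ W := by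
    intro i w hw
    rw [hmem] at hw ⊢
    intro v hv
    obtain ⟨c, hcv⟩ := heig v hv i
    have : ⟪v, T i w⟫_ℂ = ⟪T i v, w⟫_ℂ := (hs i v w).symm
    refine this.trans ?_
    rw [hcv, inner_smul_left, hw v hv, mul_zero]
  have hbot : W = ⊥ := by
    by_contra hne
    have : Nontrivial W := Submodule.nontrivial_iff_ne_bot.mpr hne
    obtain ⟨w₀, hw₀, hw₀eig⟩ := exists_joint_eigenvector (H := W)
      (T := fun i => (T i).restrict (hinv i)) (fun i => (hc i).restrict' (hinv i))
      (fun i => LinearMap.IsSymmetric.restrict_invariant (hs i) (hinv i)) (fun i j => by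
        ext v
        exact congr($(hT i j) v))
    have hw₀n : ‖(w₀ : H)‖ ≠ 0 := by simpa using hw₀
    set w : H := ((‖(w₀ : H)‖⁻¹ : ℝ) : ℂ) • (w₀ : H) with hw
    have hwW : w ∈ W := W.smul_mem _ w₀.2
    have hwn : ‖w‖ = 1 := by
      rw [hw, norm_smul, Complex.norm_real, norm_inv, norm_norm, inv_mul_cancel₀ hw₀n]
    have hwv : ∀ v ∈ s, ⟪v, w⟫_ℂ = 0 := (hmem w).mp hwW
    have hww : ⟪w, w⟫_ℂ = 1 := by rw [inner_self_eq_norm_sq_to_K, hwn]; simp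
    have hws : w ∉ s := fun h => by
      have := hwv w h
      rw [hww] at this
      exact one_ne_zero this
    have hin : insert w s ∈ {s : Set H | Orthonormal ℂ ((↑) : s → H) ∧
        ∀ v ∈ s, ∀ i, ∃ c : ℂ, T i v = c • v} := by
      refine ⟨?_, ?_⟩
      · rw [orthonormal_subtype_iff_ite] at hon ⊢
        rintro a (ha | ha) b (hb | hb)
        · rw [ha, hb, hww, if_pos rfl]
        · rw [ha, if_neg (fun h => hws (by rw [h]; exact hb)), ← inner_conj_symm, hwv b hb,
            map_zero]
        · rw [hb, if_neg (fun h => hws (by rw [← h]; exact ha)), hwv a ha]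
        · exact hon a ha b hb
      · rintro a (rfl | ha) i
        · obtain ⟨c, hc'⟩ := hw₀eig i
          have hc'' : T i (w₀ : H) = c • (w₀ : H) := congr(($hc' : H))
          exact ⟨c, by rw [hw, map_smul, hc'', smul_comm]⟩
        · exact heig a ha i
    exact hws (hmax.le_of_ge hin (Set.subset_insert w s) (Set.mem_insert w s))
  have hsp : (Submodule.span ℂ (Set.range ((↑) : s → H)))ᗮ = ⊥ := by
    rw [Subtype.range_coe]; exact hbot
  refine ⟨s, HilbertBasis.mkOfOrthogonalEqBot hon hsp, fun k i => ?_⟩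
  rw [HilbertBasis.coe_mkOfOrthogonalEqBot]
  exact heig k k.2 i

end Spectral

lemma exists_unit_smul {H : Type*} [NormedAddCommGroup H] [InnerProductSpace ℂ H] {x : H}
    (hx : x ≠ 0) : ∃ e : H, ‖e‖ = 1 ∧ x = (‖x‖ : ℂ) • e := by
  have hx' : ‖x‖ ≠ 0 := norm_ne_zero_iff.mpr hx
  refine ⟨((‖x‖⁻¹ : ℝ) : ℂ) • x, ?_, ?_⟩
  · rw [norm_smul, Complex.norm_real, norm_inv, norm_norm, inv_mul_cancel₀ hx']
  · rw [smul_smul, ← Complex.ofReal_mul, mul_inv_cancel₀ hx', Complex.ofReal_one, one_smul]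

/-! ### Slices and tensor products of trace-class operators -/

section Tensor

variable {R : Type v} [NormedAddCommGroup R] [InnerProductSpace ℂ R]
variable {H : Type u} [NormedAddCommGroup H] [InnerProductSpace ℂ H]

/-- The bounded operator `r ↦ r ⊗ h`. -/
noncomputable def htmulL (h : H) : R →L[ℂ] HTensor R H :=
  LinearMap.mkContinuous
    { toFun := fun r => htmul r h
      map_add' := fun r r' => by
        simp only [htmul, TensorProduct.add_tmul, UniformSpace.Completion.coe_add]
      map_smul' := fun c r => by
        simp only [htmul, ← TensorProduct.smul_tmul', UniformSpace.Completion.coe_smul,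
          RingHom.id_apply] } ‖h‖ fun r =>
    (norm_htmul r h).trans_le (mul_comm _ _).le

@[simp] lemma htmulL_apply (h : H) (r : R) : htmulL h r = htmul r h := rfl

lemma htmul_smul_left (c : ℂ) (r : R) (h : H) : htmul (c • r) h = c • htmul r h :=
  map_smul (htmulL h) c r

/-- The bounded operator on `R ⊗ H` with `r ⊗ h ↦ ⟪a, h⟫ r`. -/
noncomputable def slice [CompleteSpace R] (a : H) : HTensor R H →L[ℂ] R :=
  ContinuousLinearMap.adjoint (htmulL a)

lemma slice_htmul [CompleteSpace R] (a : H) (r : R) (h : H) :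
    slice a (htmul r h) = ⟪a, h⟫_ℂ • r := by
  refine ext_inner_left ℂ fun r' => ?_
  rw [slice, ContinuousLinearMap.adjoint_inner_right, htmulL_apply, inner_htmul,
    inner_smul_right, mul_comm]

/-- Vectors of `R ⊗ H` are limits of finite sums of elementary tensors. -/
lemma htensor_induction {p : HTensor R H → Prop} (hc : IsClosed {z | p z}) (h0 : p 0)
    (hadd : ∀ z z', p z → p z' → p (z + z')) (htm : ∀ r h, p (htmul r h)) (z : HTensor R H) :
    p z := by
  refine UniformSpace.Completion.induction_on z hc fun z => ?_
  induction z using TensorProduct.induction_on with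
  | zero => rwa [UniformSpace.Completion.coe_zero]
  | add z1 z2 h1 h2 => rw [UniformSpace.Completion.coe_add]; exact hadd _ _ h1 h2
  | tmul r h => exact htm r h

/-- Parseval's identity for the slices along a Parseval frame of `H`, in the form of Bessel's
inequality. -/
lemma sum_norm_slice_sq_le [CompleteSpace R] {J : Type*} {a : J → H}
    (ha : ∀ x y : H, HasSum (fun j => ⟪x, a j⟫_ℂ * ⟪a j, y⟫_ℂ) ⟪x, y⟫_ℂ)
    (z : HTensor R H) (s : Finset J) : ∑ j ∈ s, ‖slice (a j) z‖ ^ 2 ≤ ‖z‖ ^ 2 := by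
  -- For a finite `s` the inequality is a closed condition, so it suffices on the algebraic tensor
  -- product, where the full Parseval identity follows sesquilinearly from elementary tensors.
  refine UniformSpace.Completion.induction_on z
    (isClosed_le (by fun_prop) (by fun_prop)) fun z => ?_
  have key : ∀ z z' : R ⊗[ℂ] H, HasSum
      (fun j => ⟪slice (a j) (z : HTensor R H), slice (a j) (z' : HTensor R H)⟫_ℂ)
      ⟪(z : HTensor R H), (z' : HTensor R H)⟫_ℂ := by
    have h0 : ((0 : R ⊗[ℂ] H) : HTensor R H) = 0 := UniformSpace.Completion.coe_zero
    intro z z'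
    induction z using TensorProduct.induction_on with
    | zero => simp only [h0, map_zero, inner_zero_left]; exact hasSum_zero
    | add z1 z2 h1 h2 =>
      simp only [UniformSpace.Completion.coe_add, map_add, inner_add_left]
      exact h1.add h2
    | tmul r h =>
      induction z' using TensorProduct.induction_on with
      | zero => simp only [h0, map_zero, inner_zero_right]; exact hasSum_zero
      | add z1 z2 h1 h2 =>
        simp only [UniformSpace.Completion.coe_add, map_add, inner_add_right]
        exact h1.add h2
      | tmul r' h' =>
        change HasSum (fun j => ⟪slice (a j) (htmul r h), slice (a j) (htmul r' h')⟫_ℂ)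
          ⟪htmul r h, htmul r' h'⟫_ℂ
        rw [inner_htmul]
        refine ((ha h h').mul_left ⟪r, r'⟫_ℂ).congr_fun fun j => ?_
        rw [slice_htmul, slice_htmul, inner_smul_left, inner_smul_right, inner_conj_symm]
        ring
  have h1 : HasSum (fun j => ‖slice (a j) (z : HTensor R H)‖ ^ 2) (‖(z : HTensor R H)‖ ^ 2) := by
    have h2 := (key z z).mapL Complex.reCLM
    simp only [inner_self_eq_norm_sq_to_K] at h2
    simpa [← Complex.ofReal_pow] using h2
  exact sum_le_hasSum s (fun _ _ => by positivity) h1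

namespace TraceClass

lemma tensor_rankOne (r r' : R) (h h' : H) :
    (rankOne r r').tensor (rankOne h h') = rankOne (htmul r h) (htmul r' h') := by
  apply toOp_injective
  apply htensor_op_ext
  intro a b a' b'
  change ⟪htmul a b, opTensor (rankOne r r').toOp (rankOne h h').toOp (htmul a' b')⟫_ℂ = _
  rw [opTensor_htmul, inner_htmul]
  simp only [toOp_rankOne, InnerProductSpace.rankOne_apply, inner_smul_right, inner_htmul]
  ring

/-- Continuous linear maps on trace-class operators on `R ⊗ H` are determined by the rank-one
operators of elementary tensors. -/
lemma clm_ext_htmul {E : Type*} [NormedAddCommGroup E] [NormedSpace ℂ E]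
    {S T : TraceClass (HTensor R H) →L[ℂ] E}
    (h : ∀ a b c d, S (rankOne (htmul a b) (htmul c d)) = T (rankOne (htmul a b) (htmul c d))) :
    S = T := by
  have hl : ∀ (Q : TraceClass (HTensor R H) →L[ℂ] E) (z z' y : HTensor R H),
      Q (rankOne (z + z') y) = Q (rankOne z y) + Q (rankOne z' y) := fun Q z z' y =>
    (congrArg Q (rankOne_add_left z z' y)).trans (Q.map_add _ _)
  have hr : ∀ (Q : TraceClass (HTensor R H) →L[ℂ] E) (z y y' : HTensor R H),
      Q (rankOne z (y + y')) = Q (rankOne z y) + Q (rankOne z y') := fun Q z y y' =>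
    (congrArg Q (rankOne_add_right z y y')).trans (Q.map_add _ _)
  have hl0 : ∀ (Q : TraceClass (HTensor R H) →L[ℂ] E) (y : HTensor R H),
      Q (rankOne 0 y) = 0 := fun Q y => (congrArg Q (rankOne_zero_left y)).trans Q.map_zero
  have hr0 : ∀ (Q : TraceClass (HTensor R H) →L[ℂ] E) (y : HTensor R H),
      Q (rankOne y 0) = 0 := fun Q y => (congrArg Q (rankOne_zero_right y)).trans Q.map_zero
  have h1 : ∀ z c d, S (rankOne z (htmul c d)) = T (rankOne z (htmul c d)) := by
    intro z c d
    have hQ : ∀ Q : TraceClass (HTensor R H) →L[ℂ] E, Continuous fun z =>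
        Q (rankOne z (htmul c d)) := fun Q =>
      Q.continuous.comp (continuous_rankOne_left _)
    exact htensor_induction (p := fun z => S (rankOne z (htmul c d)) = T (rankOne z (htmul c d)))
      (isClosed_eq (hQ S) (hQ T)) ((hl0 S _).trans (hl0 T _).symm)
      (fun z z' h1 h2 => by rw [hl, hl, h1, h2]) (fun a b => h a b c d) z
  refine clm_ext fun z z' => ?_
  have hQ : ∀ Q : TraceClass (HTensor R H) →L[ℂ] E, Continuous fun z' => Q (rankOne z z') :=
    fun Q => Q.continuous.comp (continuous_rankOne_right _)
  exact htensor_induction (p := fun z' => S (rankOne z z') = T (rankOne z z'))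
    (isClosed_eq (hQ S) (hQ T)) ((hr0 S _).trans (hr0 T _).symm)
    (fun z z' h1 h2 => by rw [hr, hr, h1, h2]) (fun c d => h1 z c d) z'

lemma norm_tensor_le (A : TraceClass R) (B : TraceClass H) : ‖A.tensor B‖ ≤ ‖A‖ * ‖B‖ := by
  refine le_mul_of_forall_lt₀ fun α hα β hβ => ?_
  obtain ⟨a, ⟨x, y, hxy, rfl⟩, ha⟩ := (csInf_lt_iff (bddBelow_traceNormSet _)
    A.isTraceClass.nonempty).mp hα
  obtain ⟨b, ⟨x', y', hxy', rfl⟩, hb⟩ := (csInf_lt_iff (bddBelow_traceNormSet _)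
    B.isTraceClass.nonempty).mp hβ
  refine (norm_le_of_isRankOneSeries (A := A.tensor B) Nat.pairEquiv.symm
    (isRankOneSeries_tensor hxy hxy')).trans ?_
  calc _ = (∑' n, ‖x n‖ * ‖y n‖) * ∑' n, ‖x' n‖ * ‖y' n‖ := by
        rw [tsum_mul_tsum_of_summable_norm hxy.1.norm hxy'.1.norm]
        refine tsum_congr fun n => ?_
        simp only [norm_htmul]
        ring
    _ ≤ _ := mul_le_mul ha.le hb.le (tsum_nonneg fun _ => by positivity)
        ((norm_nonneg A).trans hα.le)

lemma tensor_add_left (A A' : TraceClass R) (B : TraceClass H) :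
    (A + A').tensor B = A.tensor B + A'.tensor B := by
  apply toOp_injective
  apply htensor_op_ext
  intro a b a' b'
  change ⟪htmul a b, opTensor (A + A').toOp B.toOp (htmul a' b')⟫_ℂ =
    ⟪htmul a b, opTensor A.toOp B.toOp (htmul a' b') + opTensor A'.toOp B.toOp (htmul a' b')⟫_ℂ
  simp only [opTensor_htmul, inner_add_right, inner_htmul, toOp_add, add_apply, add_mul]

lemma tensor_smul_left (c : ℂ) (A : TraceClass R) (B : TraceClass H) :
    (c • A).tensor B = c • A.tensor B := by
  apply toOp_injective
  apply htensor_op_ext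
  intro a b a' b'
  change ⟪htmul a b, opTensor (c • A).toOp B.toOp (htmul a' b')⟫_ℂ =
    ⟪htmul a b, c • opTensor A.toOp B.toOp (htmul a' b')⟫_ℂ
  simp only [opTensor_htmul, inner_smul_right, inner_htmul, toOp_smul, smul_apply, mul_assoc]

lemma tensor_add_right (A : TraceClass R) (B B' : TraceClass H) :
    A.tensor (B + B') = A.tensor B + A.tensor B' := by
  apply toOp_injective
  apply htensor_op_ext
  intro a b a' b'
  change ⟪htmul a b, opTensor A.toOp (B + B').toOp (htmul a' b')⟫_ℂ =
    ⟪htmul a b, opTensor A.toOp B.toOp (htmul a' b') + opTensor A.toOp B'.toOp (htmul a' b')⟫_ℂ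
  simp only [opTensor_htmul, inner_add_right, inner_htmul, toOp_add, add_apply, mul_add]

lemma tensor_smul_right (c : ℂ) (A : TraceClass R) (B : TraceClass H) :
    A.tensor (c • B) = c • A.tensor B := by
  apply toOp_injective
  apply htensor_op_ext
  intro a b a' b'
  change ⟪htmul a b, opTensor A.toOp (c • B).toOp (htmul a' b')⟫_ℂ =
    ⟪htmul a b, c • opTensor A.toOp B.toOp (htmul a' b')⟫_ℂ
  simp only [opTensor_htmul, inner_smul_right, inner_htmul, toOp_smul, smul_apply]
  ring

/-- The continuous linear map `A ↦ A ⊗ B`. -/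
noncomputable def tensorL (B : TraceClass H) : TraceClass R →L[ℂ] TraceClass (HTensor R H) :=
  LinearMap.mkContinuous
    { toFun := fun A => A.tensor B
      map_add' := fun A A' => tensor_add_left A A' B
      map_smul' := fun c A => tensor_smul_left c A B } ‖B‖ fun A => by
    rw [mul_comm]; exact norm_tensor_le A B

/-- The continuous linear map `B ↦ A ⊗ B`. -/
noncomputable def tensorR (A : TraceClass R) : TraceClass H →L[ℂ] TraceClass (HTensor R H) :=
  LinearMap.mkContinuous
    { toFun := fun B => A.tensor B
      map_add' := fun B B' => tensor_add_right A B B'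
      map_smul' := fun c B => tensor_smul_right c A B } ‖A‖ fun B => norm_tensor_le A B

@[simp] lemma tensorL_apply (A : TraceClass R) (B : TraceClass H) : tensorL B A = A.tensor B := rfl

@[simp] lemma tensorR_apply (A : TraceClass R) (B : TraceClass H) : tensorR A B = A.tensor B := rfl

end TraceClass

end Tensor

/-! ### Mixtures of product vectors are countably separable -/

section Separable

variable {R : Type v} [NormedAddCommGroup R] [InnerProductSpace ℂ R] [CompleteSpace R]
variable {H : Type u} [NormedAddCommGroup H] [InnerProductSpace ℂ H] [CompleteSpace H]

open TraceClass

lemma isState_rankOne_self {x : H} (hx : ‖x‖ = 1) : IsState (rankOne x x) :=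
  ⟨isPositive_rankOne_self x, by rw [trace_rankOne, inner_self_eq_norm_sq_to_K, hx]; simp⟩

/-- A mixture of pure product states, over an index set of any size, is countably separable. -/
lemma isCountablySeparable_of_hasSum {J : Type*} {r : J → R} {h : J → H} (hh : ∀ j, ‖h j‖ = 1)
    {ρ : TraceClass (HTensor R H)}
    (hρ : HasSum (fun j => rankOne (htmul (r j) (h j)) (htmul (r j) (h j))) ρ)
    (hr : HasSum (fun j => ‖r j‖ ^ 2) 1) : IsCountablySeparable ρ := by
  set S := Function.support fun j => ‖r j‖ ^ 2 with hS
  have hSc : Countable S := hr.summable.countable_support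
  have hSr : ∀ j : S, r j ≠ 0 := fun j hj => j.2 (by simp [hj])
  have hSn : Nonempty S := by
    by_contra hne
    rw [not_nonempty_iff, Set.isEmpty_coe_sort, Function.support_eq_empty_iff] at hne
    rw [hne] at hr
    exact zero_ne_one (hasSum_zero.unique hr)
  choose g hg hrg using fun j : S => exists_unit_smul (hSr j)
  -- The definition asks for strictly positive weights indexed by all of `ℕ`, but `S` may be finite.
  -- Each term is therefore split into countably many copies with weights `2 ^ (-(n + 1))`.
  obtain ⟨f⟩ : Nonempty (ℕ ≃ S × ℕ) := by
    obtain ⟨_⟩ := nonempty_denumerable (S × ℕ)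
    exact ⟨(Denumerable.eqv (S × ℕ)).symm⟩
  have hgeom : HasSum (fun n : ℕ => (1 / 2 : ℝ) ^ (n + 1)) 1 := by
    have h1 := hasSum_geometric_two.mul_right (1 / 2)
    rw [mul_one_div_cancel two_ne_zero] at h1
    exact h1.congr_fun fun n => pow_succ _ _
  have hr' : HasSum (fun j : S => ‖r j‖ ^ 2) 1 :=
    (hasSum_subtype_support (f := fun j => ‖r j‖ ^ 2)).mpr hr
  have hp : HasSum (fun q : S × ℕ => ‖r q.1‖ ^ 2 * (1 / 2 : ℝ) ^ (q.2 + 1)) 1 := by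
    have h1 := hr'.mul hgeom (hr'.summable.mul_of_nonneg hgeom.summable
      (fun _ => sq_nonneg _) (fun _ => by positivity))
    rwa [one_mul] at h1
  have hterm : ∀ j : S, rankOne (htmul (r j) (h j)) (htmul (r j) (h j)) =
      ((‖r j‖ ^ 2 : ℝ) : ℂ) • (rankOne (g j) (g j)).tensor (rankOne (h j) (h j)) := by
    intro j
    conv_lhs => rw [hrg j, htmul_smul_left, rankOne_smul_left, rankOne_smul_right, smul_smul]
    rw [tensor_rankOne, Complex.conj_ofReal]
    push_cast
    rw [sq]
  have hρ' : HasSum (fun j : S => rankOne (htmul (r j) (h j)) (htmul (r j) (h j))) ρ := by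
    have hsupp : (Function.support fun j =>
        rankOne (htmul (r j) (h j)) (htmul (r j) (h j))) ⊆ S := by
      intro j hj
      rw [Function.mem_support] at hj
      by_contra hjS
      have h0 : r j = 0 := by simpa [hS] using hjS
      have h1 : htmul (r j) (h j) = 0 := by rw [h0]; exact map_zero (htmulL (h j))
      rw [h1, rankOne_zero_left] at hj
      exact hj rfl
    exact (hasSum_subtype_iff_of_support_subset hsupp).mpr hρ
  have hsum : Summable fun q : S × ℕ => ((‖r q.1‖ ^ 2 * (1 / 2 : ℝ) ^ (q.2 + 1) : ℝ) : ℂ) •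
      (rankOne (g q.1) (g q.1)).tensor (rankOne (h q.1) (h q.1)) := by
    refine Summable.of_norm_bounded hp.summable fun q => ?_
    rw [norm_smul, Complex.norm_real, Real.norm_of_nonneg (by positivity)]
    refine mul_le_of_le_one_right (by positivity) ?_
    refine (norm_tensor_le _ _).trans ?_
    have h1 := norm_rankOne_le (g q.1) (g q.1)
    have h2 := norm_rankOne_le (h q.1) (h q.1)
    rw [hg, mul_one] at h1
    rw [hh, mul_one] at h2
    exact mul_le_one₀ h1 (norm_nonneg _) h2
  have hsumρ := hsum.hasSum.prod_fiberwise fun j => by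
    have := ((hgeom.mapL Complex.ofRealCLM).smul_const
      (rankOne (htmul (r j) (h j)) (htmul (r j) (h j))))
    refine this.congr_fun fun n => ?_
    rw [hterm, smul_smul]
    congr 1
    simp
    ring
  simp only [Complex.ofRealCLM_apply, Complex.ofReal_one, one_smul] at hsumρ
  have hρsum := hsum.hasSum
  rw [hsumρ.unique hρ'] at hρsum
  have hpn := f.hasSum_iff.mpr hp
  have hρn := f.hasSum_iff.mpr hρsum
  exact ⟨_, fun n => rankOne (g (f n).1) (g (f n).1), fun n => rankOne (h (f n).1) (h (f n).1),
    fun n => mul_pos (pow_pos (norm_pos_iff.mpr (hSr (f n).1)) 2) (by positivity), hpn,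
    fun n => isState_rankOne_self (hg _), fun n => isState_rankOne_self (hh _), hρn⟩

end Separable

open TraceClass

/-! ### Functionals on trace-class operators and diagonal operators -/

section Dual

variable {H : Type u} [NormedAddCommGroup H] [InnerProductSpace ℂ H] [CompleteSpace H]

/-- Continuous functionals on the trace-class operators are given by bounded operators. -/
lemma exists_op_of_functional (f : TraceClass H →L[ℂ] ℂ) :
    ∃ F : H →L[ℂ] H, ∀ x y, f (rankOne x y) = ⟪y, F x⟫_ℂ := by
  let B : H →L⋆[ℂ] H →L[ℂ] ℂ := LinearMap.mkContinuous₂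
    (LinearMap.mk₂'ₛₗ (starRingEnd ℂ) (RingHom.id ℂ) (fun y x => f (rankOne x y))
      (fun y y' x => by rw [rankOne_add_right]; exact f.map_add _ _)
      (fun c y x => by rw [rankOne_smul_right]; exact f.map_smul _ _)
      (fun y x x' => by rw [rankOne_add_left]; exact f.map_add _ _)
      (fun c y x => by rw [rankOne_smul_left]; exact f.map_smul _ _)) ‖f‖ fun y x => by
    calc ‖f (rankOne x y)‖ ≤ ‖f‖ * ‖rankOne x y‖ := f.le_opNorm _
      _ ≤ ‖f‖ * (‖x‖ * ‖y‖) := by gcongr; exact norm_rankOne_le x y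
      _ = ‖f‖ * ‖y‖ * ‖x‖ := by ring
  refine ⟨(InnerProductSpace.continuousLinearMapOfBilin B).adjoint, fun x y => ?_⟩
  rw [ContinuousLinearMap.adjoint_inner_right,
    InnerProductSpace.continuousLinearMapOfBilin_apply]
  rfl

/-- If a functional is represented by a self-adjoint operator `F` on rank-one operators, then it is
`X ↦ Tr (X F)`. -/
lemma trace_mul_eq_of_rankOne {f : TraceClass H →L[ℂ] ℂ} {F : H →L[ℂ] H} (hF : F.IsPositive)
    (h : ∀ x y, f (rankOne x y) = ⟪y, F x⟫_ℂ) (X : TraceClass H) :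
    trace (X.toOp * F) = f X := by
  have h1 : traceL H ∘L sandwich (ContinuousLinearMap.id ℂ H) F = f := by
    refine clm_ext fun x y => ?_
    rw [h, ContinuousLinearMap.comp_apply, sandwich_rankOne, traceL_apply, trace_rankOne]
    exact hF.isSymmetric y x
  rw [← h1, ContinuousLinearMap.comp_apply, traceL_apply, toOp_sandwich,
    hF.isSelfAdjoint.adjoint_eq]
  rfl

/-- A trace-class operator that is diagonal in a Hilbert basis is the trace-norm convergent sum
of its diagonal. -/
lemma hasSum_diagonal {ι : Type*} (w : HilbertBasis ι ℂ H) {A : TraceClass H}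
    (hA : ∀ k, ∃ c : ℂ, A.toOp (w k) = c • w k) :
    HasSum (fun k => ⟪w k, A.toOp (w k)⟫_ℂ • rankOne (w k) (w k)) A := by
  have hs : Summable fun k => ⟪w k, A.toOp (w k)⟫_ℂ • rankOne (w k) (w k) := by
    refine Summable.of_norm_bounded (hasSum_trace w A).summable.norm fun k => ?_
    rw [norm_smul]
    refine mul_le_of_le_one_right (norm_nonneg _) ((norm_rankOne_le _ _).trans ?_)
    rw [w.orthonormal.1 k, mul_one]
  have hw : ∀ k, ⟪w k, A.toOp (w k)⟫_ℂ • w k = A.toOp (w k) := by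
    intro k
    obtain ⟨c, hc⟩ := hA k
    rw [hc, inner_smul_right, inner_self_eq_norm_sq_to_K, w.orthonormal.1 k]
    simp
  have hsum : ∑' k, ⟪w k, A.toOp (w k)⟫_ℂ • rankOne (w k) (w k) = A := by
    apply toOp_injective
    ext1 y
    refine ((hasSum_toOp hs.hasSum).mapL (ContinuousLinearMap.apply ℂ H y)).unique ?_
    refine ((w.hasSum_repr y).mapL A.toOp).congr_fun fun k => ?_
    rw [map_smul, ← hw k, w.repr_apply_apply]
    simp [smul_smul, mul_comm, w.orthonormal.1 k]
  have h := hs.hasSum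
  rwa [hsum] at h

end Dual

/-! ### Measure-and-prepare form of a channel with commutative range -/

section Holevo

variable {H : Type u} [NormedAddCommGroup H] [InnerProductSpace ℂ H] [CompleteSpace H]
variable {K : Type v} [NormedAddCommGroup K] [InnerProductSpace ℂ K] [CompleteSpace K]

namespace IsChannel

/-- A channel as a continuous linear map for the trace norms. -/
noncomputable def toCLM {Φ : TraceClass H →ₗ[ℂ] TraceClass K} (hΦ : IsChannel Φ) :
    TraceClass H →L[ℂ] TraceClass K := Φ.mkContinuous 4 hΦ.norm_map_le

@[simp] lemma toCLM_apply {Φ : TraceClass H →ₗ[ℂ] TraceClass K} (hΦ : IsChannel Φ)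
    (X : TraceClass H) : hΦ.toCLM X = Φ X := rfl

/-- A channel with commutative range is diagonal in some Hilbert basis. -/
lemma exists_basis_of_commutativeRange {Φ : TraceClass H →ₗ[ℂ] TraceClass K} (hΦ : IsChannel Φ)
    (hcomm : HasCommutativeRange Φ) : ∃ (s : Set K) (w : HilbertBasis s ℂ K),
      ∀ (X : TraceClass H) k, ∃ c : ℂ, (Φ X).toOp (w k) = c • w k := by
  -- Only positive inputs are used as indices, since their images are self-adjoint; the remaining
  -- inputs follow by linearity from the four-term decomposition.
  obtain ⟨s, w, hw⟩ := exists_hilbertBasis_joint_eigenvectors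
    (T := fun X : {X : TraceClass H // X.toOp.IsPositive} => (Φ X).toOp)
    (fun X => (Φ X).isTraceClass.isCompactOperator)
    (fun X => (hΦ.isPositive_map X.2).isSymmetric) (fun X Y => hcomm X Y)
  refine ⟨s, w, fun X k => ?_⟩
  obtain ⟨P, hP, -, hX⟩ := exists_positive_decomposition X one_pos
  choose c hc using fun z => hw k ⟨P z, hP z⟩
  have heq : Φ X = (1 / 4 : ℂ) • (Φ (P 1) - Φ (P (-1)) + Complex.I • Φ (P Complex.I) -
      Complex.I • Φ (P (-Complex.I))) := by
    conv_lhs => rw [hX]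
    simp only [map_smul, map_sub, map_add]
  refine ⟨(1 / 4 : ℂ) * (c 1 - c (-1) + Complex.I * c Complex.I - Complex.I * c (-Complex.I)), ?_⟩
  rw [heq]
  simp only [toOp_smul, toOp_sub, toOp_add, smul_apply, add_apply, sub_apply, hc]
  module

/-- A channel with commutative range is a measurement followed by a preparation of the vectors of
a Hilbert basis. -/
lemma exists_measure_prepare {Φ : TraceClass H →ₗ[ℂ] TraceClass K} (hΦ : IsChannel Φ)
    (hcomm : HasCommutativeRange Φ) : ∃ (s : Set K) (w : HilbertBasis s ℂ K) (F : s → H →L[ℂ] H),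
      (∀ k, (F k).IsPositive) ∧ (∀ x y, HasSum (fun k => ⟪x, F k y⟫_ℂ) ⟪x, y⟫_ℂ) ∧
      ∀ X : TraceClass H, HasSum (fun k => trace (X.toOp * F k) • rankOne (w k) (w k)) (Φ X) := by
  obtain ⟨s, w, hw⟩ := hΦ.exists_basis_of_commutativeRange hcomm
  let f : s → TraceClass H →L[ℂ] ℂ := fun k =>
    innerSL ℂ (w k) ∘L ContinuousLinearMap.apply ℂ K (w k) ∘L toOpL K ∘L hΦ.toCLM
  have hf : ∀ k X, f k X = ⟪w k, (Φ X).toOp (w k)⟫_ℂ := fun k X => rfl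
  choose F hF using fun k => exists_op_of_functional (f k)
  have hpos : ∀ k, (F k).IsPositive := fun k => isPositive_of_inner_nonneg fun x => by
    rw [← hF, hf]
    exact (hΦ.isPositive_map (isPositive_rankOne_self x)).inner_nonneg_right _
  refine ⟨s, w, F, hpos, fun x y => ?_, fun X => ?_⟩
  -- Trace preservation on `y x^*` is exactly the statement that the effects sum weakly to the
  -- identity.
  · have h1 := hasSum_trace w (Φ (rankOne y x))
    rw [hΦ.tracePreserving, trace_rankOne] at h1
    exact h1.congr_fun fun k => by rw [← hF, hf]
  · refine (hasSum_diagonal w (hw X)).congr_fun fun k => ?_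
    rw [trace_mul_eq_of_rankOne (hpos k) (hF k), hf]

end IsChannel

end Holevo

/-! ### The ampliation and its separable outputs -/

section Ampliation

variable {H : Type u} [NormedAddCommGroup H] [InnerProductSpace ℂ H]
variable {K : Type v} [NormedAddCommGroup K] [InnerProductSpace ℂ K]

/-- If `Φ X = ∑ j, ⟪a j, X (a j)⟫ w j (w j)^*` for a Parseval frame `a` and unit vectors `w`, then
`I_R ⊗ Φ` is `Z ↦ ∑ j, L j Z (L j)^*` with `L j = I_R ⊗ w j (a j)^*`. -/
lemma exists_ampliation [CompleteSpace H] (R : Type w) [NormedAddCommGroup R]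
    [InnerProductSpace ℂ R] [CompleteSpace R] {Φ : TraceClass H →L[ℂ] TraceClass K} {J : Type*} {a : J → H} {b : J → K}
    (ha : ∀ x y : H, HasSum (fun j => ⟪x, a j⟫_ℂ * ⟪a j, y⟫_ℂ) ⟪x, y⟫_ℂ) (hb : ∀ j, ‖b j‖ = 1)
    (hΦ : ∀ x y, HasSum (fun j => (⟪y, a j⟫_ℂ * ⟪a j, x⟫_ℂ) • rankOne (b j) (b j))
      (Φ (rankOne x y))) :
    ∃ Ψ : TraceClass (HTensor R H) →L[ℂ] TraceClass (HTensor R K), IsAmpliation Φ.toLinearMap Ψ ∧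
      (∀ Z, trace (Ψ Z).toOp = trace Z.toOp) ∧
      ∀ z z', HasSum (fun j => rankOne (htmul (slice (a j) z) (b j)) (htmul (slice (a j) z') (b j)))
        (Ψ (rankOne z z')) := by
  let L : J → HTensor R H →L[ℂ] HTensor R K := fun j => htmulL (b j) ∘L slice (a j)
  have hLapp : ∀ j z, L j z = htmul (slice (a j) z) (b j) := fun j z => rfl
  have hL : ∀ (z : HTensor R H) (s : Finset J), ∑ j ∈ s, ‖L j z‖ ^ 2 ≤ ‖z‖ ^ 2 := fun z s => by
    simpa only [hLapp, norm_htmul, hb, mul_one] using sum_norm_slice_sq_le ha z s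
  have hΨ : ∀ z z', HasSum (fun j => rankOne (htmul (slice (a j) z) (b j))
      (htmul (slice (a j) z') (b j))) (kraus L hL (rankOne z z')) := fun z z' =>
    (hasSum_kraus hL (rankOne z z')).congr_fun fun j => by rw [sandwich_rankOne, hLapp, hLapp]
  have hterm : ∀ (r r' : R) (h h' : H) j, rankOne (htmul (slice (a j) (htmul r h)) (b j))
      (htmul (slice (a j) (htmul r' h')) (b j)) =
      (⟪h', a j⟫_ℂ * ⟪a j, h⟫_ℂ) • rankOne (htmul r (b j)) (htmul r' (b j)) := by
    intro r r' h h' j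
    rw [slice_htmul, slice_htmul, htmul_smul_left, htmul_smul_left, rankOne_smul_left,
      rankOne_smul_right, smul_smul, inner_conj_symm, mul_comm]
  refine ⟨kraus L hL, fun A B => ?_, fun Z => ?_, hΨ⟩
  -- Both sides are continuous and linear in each tensor factor separately, so the identity is
  -- checked on rank-one operators in one factor and then in the other.
  · have hr : ∀ (r r' : R), kraus L hL ∘L tensorR (rankOne r r') = tensorR (rankOne r r') ∘L Φ := by
      intro r r'
      refine clm_ext fun x y => ?_
      rw [ContinuousLinearMap.comp_apply, ContinuousLinearMap.comp_apply, tensorR_apply,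
        tensor_rankOne]
      refine (hΨ _ _).unique (((hΦ x y).mapL (tensorR (rankOne r r'))).congr_fun fun j => ?_)
      rw [hterm, map_smul, tensorR_apply, tensor_rankOne]
    have hB : kraus L hL ∘L tensorL B = tensorL (Φ B) :=
      clm_ext fun r r' => congr($(hr r r') B)
    exact congr($hB A)
  · have ht : traceL (HTensor R K) ∘L kraus L hL = traceL (HTensor R H) := by
      refine clm_ext_htmul fun r h r' h' => ?_
      rw [ContinuousLinearMap.comp_apply, traceL_apply, traceL_apply]
      have h1 := hasSum_trace_of_hasSum (hΨ (htmul r h) (htmul r' h'))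
      refine h1.unique ?_
      rw [trace_rankOne, inner_htmul]
      refine ((ha h' h).mul_left ⟪r', r⟫_ℂ).congr_fun fun j => ?_
      rw [trace_rankOne, inner_htmul, slice_htmul, slice_htmul, inner_smul_left, inner_smul_right,
        inner_conj_symm, inner_self_eq_norm_sq_to_K, hb]
      simp
      ring
    exact congr($ht Z)

/-- Measure-and-prepare ampliations send states to countably separable states. -/
lemma isCountablySeparable_of_hasSum_ampliation [CompleteSpace K] {R : Type w}
    [NormedAddCommGroup R] [InnerProductSpace ℂ R] [CompleteSpace R] {J : Type*} {a : J → H} {b : J → K}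
    (hb : ∀ j, ‖b j‖ = 1)
    {Ψ : TraceClass (HTensor R H) →L[ℂ] TraceClass (HTensor R K)}
    (htr : ∀ Z, trace (Ψ Z).toOp = trace Z.toOp)
    (hΨ : ∀ z z', HasSum (fun j => rankOne (htmul (slice (a j) z) (b j))
      (htmul (slice (a j) z') (b j))) (Ψ (rankOne z z')))
    {ρ : TraceClass (HTensor R H)} (hρ : IsState ρ) :
    IsState (Ψ ρ) ∧ IsCountablySeparable (Ψ ρ) := by
  obtain ⟨I, e, -⟩ := exists_hilbertBasis ℂ (HTensor R H)
  obtain ⟨z, hzs, hz⟩ := exists_hasSum_rankOne_self e hρ.1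
  have hΨz : HasSum (fun n => Ψ (rankOne (z n) (z n))) (Ψ ρ) := hz.mapL Ψ
  have hn : ∀ (r : R) j, ‖htmul r (b j)‖ = ‖r‖ := fun r j => by rw [norm_htmul, hb, mul_one]
  -- Trace preservation turns into an equality of squared norms, which gives summability over all
  -- pairs and so allows the expansion of the state and the Kraus sum to be merged into one series.
  have hnorm : ∀ n, HasSum (fun j => ‖slice (a j) (z n)‖ ^ 2) (‖z n‖ ^ 2) := by
    intro n
    have h1 := hasSum_norm_sq (hΨ (z n) (z n))
    rw [htr, trace_rankOne, inner_self_eq_norm_sq_to_K] at h1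
    simpa [hn, ← Complex.ofReal_pow] using h1
  let r : I × J → R := fun q => slice (a q.2) (z q.1)
  have hprod : Summable fun q => ‖r q‖ ^ 2 := by
    rw [summable_prod_of_nonneg (fun q => by positivity)]
    exact ⟨fun n => (hnorm n).summable, hzs.congr fun n => (hnorm n).tsum_eq.symm⟩
  have hsum : Summable fun q => rankOne (htmul (r q) (b q.2)) (htmul (r q) (b q.2)) := by
    refine summable_rankOne (x := fun q => htmul (r q) (b q.2))
      (y := fun q => htmul (r q) (b q.2)) (hprod.congr fun q => ?_)
    rw [hn, sq]
  have hall : HasSum (fun q => rankOne (htmul (r q) (b q.2)) (htmul (r q) (b q.2))) (Ψ ρ) := by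
    have h1 := hsum.hasSum
    rwa [(h1.prod_fiberwise fun n => hΨ (z n) (z n)).unique hΨz] at h1
  have htr1 : trace (Ψ ρ).toOp = 1 := (htr ρ).trans hρ.2
  have h1 := hasSum_norm_sq (z := fun q => htmul (r q) (b q.2)) hall
  rw [htr1, Complex.one_re] at h1
  exact ⟨⟨isPositive_of_hasSum hall fun q => isPositive_rankOne_self _, htr1⟩,
    isCountablySeparable_of_hasSum (r := r) (h := fun q => b q.2) (fun q => hb q.2) hall
      (h1.congr_fun fun q => by rw [hn])⟩

end Ampliation

/-! ### Frames, the weighted Choi operator and its blocks -/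

section Frames

variable {H : Type u} [NormedAddCommGroup H] [InnerProductSpace ℂ H]

lemma trace_rankOne_mul [CompleteSpace H] {F : H →L[ℂ] H} (hF : F.IsPositive) (x y : H) :
    trace ((rankOne x y).toOp * F) = ⟪y, F x⟫_ℂ := by
  have h : (rankOne x y).toOp * F = (rankOne x (F y)).toOp := by
    ext z
    simp [hF.inner_left_eq_inner_right]
  rw [h, trace_rankOne]
  exact hF.isSymmetric y x

/-- Frames of the effects of a measurement combine to a Parseval frame. -/
lemma hasSum_frame_prod {S M : Type*} {F : S → H →L[ℂ] H} {a : S → M → H}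
    (hF : ∀ x y, HasSum (fun k => ⟪x, F k y⟫_ℂ) ⟪x, y⟫_ℂ)
    (ha : ∀ k x y, HasSum (fun m => ⟪x, a k m⟫_ℂ * ⟪a k m, y⟫_ℂ) ⟪x, F k y⟫_ℂ) (x y : H) :
    HasSum (fun j : S × M => ⟪x, a j.1 j.2⟫_ℂ * ⟪a j.1 j.2, y⟫_ℂ) ⟪x, y⟫_ℂ := by
  -- Passing from iterated to double sums needs absolute convergence; it comes from the diagonal
  -- case `x = y`, where all terms are nonnegative, via `|u v| ≤ |u| ^ 2 + |v| ^ 2`.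
  have hsq : ∀ x : H, Summable fun j : S × M => ‖⟪a j.1 j.2, x⟫_ℂ‖ ^ 2 := by
    intro x
    have h1 : ∀ k, HasSum (fun m => ‖⟪a k m, x⟫_ℂ‖ ^ 2) (⟪x, F k x⟫_ℂ).re := fun k =>
      ((ha k x x).mapL Complex.reCLM).congr_fun fun m => by
        rw [← inner_conj_symm x, Complex.conj_mul']
        simp [← Complex.ofReal_pow]
    rw [summable_prod_of_nonneg (fun q => by positivity)]
    exact ⟨fun k => (h1 k).summable,
      ((hF x x).mapL Complex.reCLM).summable.congr fun k => (h1 k).tsum_eq.symm⟩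
  have hs : Summable fun j : S × M => ⟪x, a j.1 j.2⟫_ℂ * ⟪a j.1 j.2, y⟫_ℂ := by
    refine Summable.of_norm_bounded ((hsq x).add (hsq y)) fun j => ?_
    rw [norm_mul, norm_inner_symm x]
    nlinarith [sq_nonneg (‖⟪a j.1 j.2, x⟫_ℂ‖ - ‖⟪a j.1 j.2, y⟫_ℂ‖),
      sq_nonneg ‖⟪a j.1 j.2, x⟫_ℂ‖, sq_nonneg ‖⟪a j.1 j.2, y⟫_ℂ‖]
  have h1 := hs.hasSum
  rwa [(h1.prod_fiberwise fun k => ha k x y).unique (hF x y)] at h1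

/-- The `ℓ²` vector `∑ i, √(l i) e i ⊗ e i` of a probability vector `l`. -/
lemma exists_hasSum_htmul_self {ι : Type*} {e : ι → H} (he : Orthonormal ℂ e) {l : ι → ℝ}
    (hl : ∀ i, 0 < l i) (hl1 : HasSum l 1) :
    ∃ ω : HTensor H H, ‖ω‖ = 1 ∧ HasSum (fun i => (√(l i) : ℂ) • htmul (e i) (e i)) ω := by
  classical
  have hon : Orthonormal ℂ fun i => htmul (e i) (e i) := by
    rw [orthonormal_iff_ite] at he ⊢
    intro i j
    rw [inner_htmul, he i j]
    split_ifs <;> simp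
  have hs : Summable fun i => (√(l i) : ℂ) • htmul (e i) (e i) := by
    have h1 := (hon.orthogonalFamily.summable_iff_norm_sq_summable fun i => (√(l i) : ℂ)).mpr
      (hl1.summable.congr fun i => by
        rw [Complex.norm_real, Real.norm_of_nonneg (Real.sqrt_nonneg _), Real.sq_sqrt (hl i).le])
    simpa using h1
  refine ⟨_, ?_, hs.hasSum⟩
  set ω := ∑' i, (√(l i) : ℂ) • htmul (e i) (e i) with hω
  have hinner : ∀ i, ⟪ω, htmul (e i) (e i)⟫_ℂ = √(l i) := by
    intro i
    have h1 := hs.hasSum.mapL (innerSL ℂ (htmul (e i) (e i)))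
    have h2 : ⟪htmul (e i) (e i), ω⟫_ℂ = √(l i) := by
      refine h1.unique ?_
      have h3 := hasSum_single (f := fun j => innerSL ℂ (htmul (e i) (e i))
        ((√(l j) : ℂ) • htmul (e j) (e j))) i fun j hj => by
          rw [innerSL_apply_apply, inner_smul_right, orthonormal_iff_ite.mp hon, if_neg hj.symm,
            mul_zero]
      rwa [innerSL_apply_apply, inner_smul_right, orthonormal_iff_ite.mp hon, if_pos rfl,
        mul_one] at h3
    rw [← inner_conj_symm, h2, Complex.conj_ofReal]
  have h1 : ⟪ω, ω⟫_ℂ = 1 := by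
    refine (hs.hasSum.mapL (innerSL ℂ ω)).unique ?_
    have h2 := hl1.mapL Complex.ofRealCLM
    rw [Complex.ofRealCLM_apply, Complex.ofReal_one] at h2
    refine h2.congr_fun fun i => ?_
    rw [innerSL_apply_apply, inner_smul_right, hinner, ← Complex.ofReal_mul,
      Real.mul_self_sqrt (hl i).le, Complex.ofRealCLM_apply]
  have h2 : ‖ω‖ ^ 2 = 1 := by rw [@norm_sq_eq_re_inner ℂ, h1, RCLike.one_re]
  exact (pow_eq_one_iff_of_nonneg (norm_nonneg _) two_ne_zero).mp h2

/-- The partial sum over a square `s × s` is `Ψ` applied to the rank-one operator of the partial sum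
of `ω`, so the convergence is continuity of `Ψ` and of `z ↦ z z^*`. -/
lemma isWeightedChoi_of_isAmpliation {ι : Type*} {e : ι → H} {l : ι → ℝ} (hl : ∀ i, 0 < l i)
    {ω : HTensor H H} (hω : HasSum (fun i => (√(l i) : ℂ) • htmul (e i) (e i)) ω)
    {K : Type v} [NormedAddCommGroup K] [InnerProductSpace ℂ K] [CompleteSpace K]
    [CompleteSpace H] {Φ : TraceClass H →ₗ[ℂ] TraceClass K}
    {Ψ : TraceClass (HTensor H H) →L[ℂ] TraceClass (HTensor H K)} (hΨ : IsAmpliation Φ Ψ) :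
    IsWeightedChoi Φ e l (Ψ (rankOne ω ω)) := by
  have h1 : Tendsto (fun s : Finset ι => Ψ (rankOne (∑ i ∈ s, (√(l i) : ℂ) • htmul (e i) (e i))
      (∑ i ∈ s, (√(l i) : ℂ) • htmul (e i) (e i)))) atTop (𝓝 (Ψ (rankOne ω ω))) :=
    (Ψ.continuous.tendsto _).comp (tendsto_rankOne hω hω)
  refine h1.congr fun s => ?_
  rw [rankOne_sum_left, map_sum]
  refine Finset.sum_congr rfl fun i _ => ?_
  rw [rankOne_sum_right, map_sum]
  refine Finset.sum_congr rfl fun j _ => ?_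
  rw [rankOne_smul_left, rankOne_smul_right, smul_smul, map_smul, ← tensor_rankOne, hΨ,
    Complex.conj_ofReal, Real.sqrt_mul (hl i).le, Complex.ofReal_mul]

lemma _root_.HilbertBasis.op_eq_zero_of_inner {ι : Type*} (e : HilbertBasis ι ℂ H) {A : H →L[ℂ] H}
    (h : ∀ i j, ⟪e i, A (e j)⟫_ℂ = 0) : A = 0 := by
  have h1 : ∀ j, A (e j) = 0 := fun j => by
    refine (e.hasSum_repr (A (e j))).unique ?_
    simp only [e.repr_apply_apply, h, zero_smul]
    exact hasSum_zero
  ext1 x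
  refine ((e.hasSum_repr x).mapL A).unique ?_
  simp only [map_smul, h1, smul_zero]
  exact hasSum_zero

/-- The coordinates of the slice are those of `a`, conjugated and weighted by `√(l j)`. The
conjugation is the source of the transpose in the formula for `F k`. -/
lemma inner_slice {ι : Type*} {e : ι → H} (he : Orthonormal ℂ e) {l : ι → ℝ} {ω : HTensor H H}
    [CompleteSpace H] (hω : HasSum (fun i => (√(l i) : ℂ) • htmul (e i) (e i)) ω) (a : H) (j : ι) :
    ⟪e j, slice a ω⟫_ℂ = √(l j) * ⟪a, e j⟫_ℂ := by
  have h1 : HasSum (fun i => (√(l i) : ℂ) * (⟪a, e i⟫_ℂ * ⟪e j, e i⟫_ℂ)) ⟪e j, slice a ω⟫_ℂ := by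
    refine (hω.mapL (innerSL ℂ (e j) ∘L slice a)).congr_fun fun i => ?_
    rw [ContinuousLinearMap.comp_apply, map_smul, slice_htmul, innerSL_apply_apply,
      inner_smul_right, inner_smul_right]
  have h2 := hasSum_single (f := fun i => (√(l i) : ℂ) * (⟪a, e i⟫_ℂ * ⟪e j, e i⟫_ℂ)) j
    fun i hi => by rw [he.2 hi.symm, mul_zero, mul_zero]
  rw [h1.unique h2, inner_self_eq_norm_sq_to_K, he.1 j]
  simp

lemma inner_eq_of_hasSum_slice {ι M : Type*} {e : ι → H} (he : Orthonormal ℂ e) {l : ι → ℝ}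
    {ω : HTensor H H} [CompleteSpace H]
    (hω : HasSum (fun i => (√(l i) : ℂ) • htmul (e i) (e i)) ω) {a : M → H} {T : TraceClass H}
    {F : H →L[ℂ] H} (hT : HasSum (fun m => rankOne (slice (a m) ω) (slice (a m) ω)) T)
    (hF : ∀ x y, HasSum (fun m => ⟪x, a m⟫_ℂ * ⟪a m, y⟫_ℂ) ⟪x, F y⟫_ℂ) (i j : ι) :
    ⟪e j, T.toOp (e i)⟫_ℂ = (√(l i) * √(l j) : ℂ) * ⟪e i, F (e j)⟫_ℂ := by
  refine (hasSum_inner hT (e j) (e i)).unique ?_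
  refine ((hF (e i) (e j)).mul_left _).congr_fun fun m => ?_
  rw [toOp_rankOne, InnerProductSpace.inner_right_rankOne_apply, inner_slice he hω,
    ← inner_conj_symm (slice (a m) ω), inner_slice he hω, map_mul, inner_conj_symm, Complex.conj_ofReal]
  ring

lemma trace_eq_re_of_isPositive [CompleteSpace H] {A : TraceClass H} (hA : A.toOp.IsPositive) :
    trace A.toOp = (trace A.toOp).re := by
  obtain ⟨I, e, -⟩ := exists_hilbertBasis ℂ H
  have h := (hasSum_trace e A).nonneg fun i => hA.inner_nonneg_right (e i)
  exact (Complex.eq_re_of_ofReal_le (r := 0) (by simpa using h))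

/-- A sum of product rank-one operators grouped along the second factor. -/
lemma exists_block_decomposition {R : Type w} [NormedAddCommGroup R] [InnerProductSpace ℂ R]
    [CompleteSpace R] [CompleteSpace H] {S M : Type*} {c : S → M → R} {b : S → H}
    (hb : ∀ k, ‖b k‖ = 1) {σ : TraceClass (HTensor R H)} (hσ1 : trace σ.toOp = 1)
    (hσ : HasSum (fun j : S × M => rankOne (htmul (c j.1 j.2) (b j.1))
      (htmul (c j.1 j.2) (b j.1))) σ) :
    ∃ T : S → TraceClass R, (∀ k, HasSum (fun m => rankOne (c k m) (c k m)) (T k)) ∧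
      HasSum (fun k => (T k).tensor (rankOne (b k) (b k))) σ ∧
      HasSum (fun k => (trace (T k).toOp).re) 1 := by
  have hcn : HasSum (fun j : S × M => ‖c j.1 j.2‖ ^ 2) 1 := by
    have h1 := hasSum_norm_sq (z := fun j : S × M => htmul (c j.1 j.2) (b j.1)) hσ
    rw [hσ1, Complex.one_re] at h1
    exact h1.congr_fun fun j => by rw [norm_htmul, hb, mul_one]
  have hck : ∀ k, Summable fun m => ‖c k m‖ ^ 2 := fun k => hcn.summable.prod_factor k
  have hT : ∀ k, HasSum (fun m => rankOne (c k m) (c k m)) (∑' m, rankOne (c k m) (c k m)) :=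
    fun k => (summable_rankOne (x := c k) (y := c k) ((hck k).congr fun m => sq _)).hasSum
  refine ⟨_, hT, ?_, hcn.prod_fiberwise fun k => hasSum_norm_sq (hT k)⟩
  have hTk : ∀ k, HasSum (fun m => rankOne (htmul (c k m) (b k)) (htmul (c k m) (b k)))
      ((∑' m, rankOne (c k m) (c k m)).tensor (rankOne (b k) (b k))) := fun k =>
    ((hT k).mapL (tensorL (rankOne (b k) (b k)))).congr_fun fun m => by
      rw [tensorL_apply, tensor_rankOne]
  exact hσ.prod_fiberwise hTk

end Frames

/-- Summability makes the support countable, hence a copy of a subset of `ℕ`; this places the index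
type in `Type` whatever the universe of `S`. -/
lemma exists_countable_reindex {S : Type*} {q : S → ℝ} (hq : Summable q) :
    ∃ (κ : Type) (_ : Countable κ) (g : κ → S), Function.Injective g ∧
      Set.range g = Function.support q := by
  have hc : Countable (Function.support q) := hq.countable_support
  obtain ⟨f, hf⟩ := hc.exists_injective_nat
  let E := Equiv.ofInjective f hf
  refine ⟨Set.range f, inferInstance, fun k => (E.symm k : S),
    Subtype.val_injective.comp E.symm.injective, ?_⟩
  rw [show (fun k => (E.symm k : S)) = Subtype.val ∘ E.symm from rfl, E.symm.surjective.range_comp,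
    Subtype.range_coe]

end QChannel

/-! ### The main theorem -/

open QChannel TraceClass in
theorem theorem2p2 {H : Type u} [NormedAddCommGroup H] [InnerProductSpace ℂ H] [CompleteSpace H]
    [TopologicalSpace.SeparableSpace H] {ι : Type v} (e : HilbertBasis ι ℂ H)
    (Φ : TraceClass H →ₗ[ℂ] TraceClass H) (hΦ : IsChannel Φ) (hcomm : HasCommutativeRange Φ) :
    IsStronglyEntanglementBreaking.{u, u, w} Φ ∧
    ∀ l : ι → ℝ, (∀ i, 0 < l i) → HasSum l 1 →
      ∃ σ : TraceClass (HTensor H H), IsWeightedChoi Φ e l σ ∧ IsState σ ∧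
        IsCountablySeparable σ ∧
        ∃ (κ : Type) (_ : Countable κ) (p : κ → ℝ) (ρ : κ → TraceClass H) (v : κ → H),
          (∀ k, 0 < p k) ∧ HasSum p 1 ∧ (∀ k, IsState (ρ k)) ∧ Orthonormal ℂ v ∧
          HasSum (fun k => (p k : ℂ) • (ρ k).tensor (TraceClass.rankOne (v k) (v k))) σ ∧
          ∃ (U : H ≃ₗᵢ[ℂ] H) (F : κ → (H →L[ℂ] H)),
            (∀ k, (F k).IsPositive) ∧
            (∀ k i j, ⟪e i, F k (e j)⟫_ℂ =
              ((p k / √(l i * l j) : ℝ) : ℂ) * ⟪e j, (ρ k).toOp (e i)⟫_ℂ) ∧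
            (∀ x y : H, HasSum (fun k => ⟪x, F k y⟫_ℂ) ⟪x, y⟫_ℂ) ∧
            ∀ X : TraceClass H,
              HasSum (fun k => trace (X.toOp * F k) •
                TraceClass.rankOne (U (v k)) (U (v k))) (Φ X) := by
  obtain ⟨s, b, F, hpos, hF, hΦF⟩ := hΦ.exists_measure_prepare hcomm
  choose a ha _ using fun k => exists_frame_of_isPositive e (hpos k)
  have hbn : ∀ k, ‖b k‖ = 1 := b.orthonormal.1
  let aJ : s × ι → H := fun j => a j.1 j.2
  let bJ : s × ι → H := fun j => b j.1
  have hbJ : ∀ j, ‖bJ j‖ = 1 := fun j => hbn j.1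
  have haJ : ∀ x y, HasSum (fun j => ⟪x, aJ j⟫_ℂ * ⟪aJ j, y⟫_ℂ) ⟪x, y⟫_ℂ :=
    hasSum_frame_prod hF ha
  have hΦJ : ∀ x y, HasSum (fun j => (⟪y, aJ j⟫_ℂ * ⟪aJ j, x⟫_ℂ) • rankOne (bJ j) (bJ j))
      (hΦ.toCLM (rankOne x y)) := by
    intro x y
    have hs : Summable fun j => (⟪y, aJ j⟫_ℂ * ⟪aJ j, x⟫_ℂ) • rankOne (bJ j) (bJ j) := by
      refine Summable.of_norm_bounded (haJ y x).summable.norm fun j => ?_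
      rw [norm_smul]
      refine mul_le_of_le_one_right (norm_nonneg _) ((norm_rankOne_le _ _).trans ?_)
      rw [hbJ, mul_one]
    have h1 := hs.hasSum
    -- Summing over `m` first recovers the measure-and-prepare formula, which identifies the limit
    -- of the double series.
    have h2 := h1.prod_fiberwise fun k => (ha k y x).smul_const (rankOne (b k) (b k))
    have h3 := hΦF (rankOne x y)
    simp only [trace_rankOne_mul (hpos _)] at h3
    rwa [h2.unique h3] at h1
  refine ⟨fun R _ _ _ => ?_, fun l hl hl1 => ?_⟩
  · obtain ⟨Ψ, hΨ, htr, hsum⟩ := exists_ampliation R haJ hbJ hΦJ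
    exact ⟨Ψ, hΨ, fun ρ hρ =>
      (isCountablySeparable_of_hasSum_ampliation (a := aJ) hbJ htr hsum hρ).2⟩
  obtain ⟨Ψ, hΨ, htr, hsum⟩ := exists_ampliation H haJ hbJ hΦJ
  obtain ⟨ω, hω1, hω⟩ := exists_hasSum_htmul_self e.orthonormal hl hl1
  have hσ := isCountablySeparable_of_hasSum_ampliation (a := aJ) hbJ htr hsum
    (isState_rankOne_self hω1)
  refine ⟨Ψ (rankOne ω ω), isWeightedChoi_of_isAmpliation hl hω hΨ, hσ.1, hσ.2, ?_⟩
  obtain ⟨T, hT, hTσ, hq1⟩ := exists_block_decomposition (c := fun k m => slice (a k m) ω)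
    (b := fun k => b k) hbn hσ.1.2 (hsum ω ω)
  set q : s → ℝ := fun k => (trace (T k).toOp).re with hq
  have hTpos : ∀ k, (T k).toOp.IsPositive := fun k =>
    isPositive_of_hasSum (hT k) fun m => isPositive_rankOne_self _
  have hTtr : ∀ k, trace (T k).toOp = q k := fun k => trace_eq_re_of_isPositive (hTpos k)
  have hTzero : ∀ k, q k = 0 → T k = 0 := fun k hk =>
    norm_le_zero_iff.mp ((norm_le_trace_of_isPositive (hTpos k)).trans_eq hk)
  have hentry : ∀ k i j, ⟪e j, (T k).toOp (e i)⟫_ℂ =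
      ((√(l i * l j) : ℝ) : ℂ) * ⟪e i, F k (e j)⟫_ℂ := fun k i j => by
    rw [inner_eq_of_hasSum_slice e.orthonormal hω (hT k) (ha k), Real.sqrt_mul (hl i).le,
      Complex.ofReal_mul]
  have hne : ∀ i j, ((√(l i * l j) : ℝ) : ℂ) ≠ 0 := fun i j => by
    exact_mod_cast (Real.sqrt_pos.mpr (mul_pos (hl i) (hl j))).ne'
  -- Indices with `q k = 0` are about to be dropped to make the weights strictly positive. The entry
  -- formula, whose weights do not vanish, shows that their effects vanish too, so no later sum
  -- changes.
  have hFzero : ∀ k, q k = 0 → F k = 0 := fun k hk => e.op_eq_zero_of_inner fun i j => by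
    have h1 := hentry k i j
    rw [hTzero k hk, toOp_zero, zero_apply, inner_zero_right, eq_comm, mul_eq_zero] at h1
    exact h1.resolve_left (hne i j)
  have hq0 : ∀ k, 0 ≤ q k := fun k => (norm_nonneg _).trans (norm_le_trace_of_isPositive (hTpos k))
  obtain ⟨κ, hκ, g, hg, hrange⟩ := exists_countable_reindex hq1.summable
  have hqg : ∀ k, 0 < q (g k) := fun k => (hq0 _).lt_of_ne' (by
    have : g k ∈ Function.support q := hrange ▸ Set.mem_range_self k
    exact this)
  have hout : ∀ k, k ∉ Set.range g → q k = 0 := fun k hk => by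
    rw [hrange] at hk
    simpa using hk
  have hqC : ∀ k, (q (g k) : ℂ) ≠ 0 := fun k => by exact_mod_cast (hqg k).ne'
  -- The vectors `v k` are taken to be the diagonalising basis vectors of `Φ` themselves, so the
  -- unitary can be the identity.
  refine ⟨κ, hκ, fun k => q (g k), fun k => ((q (g k))⁻¹ : ℂ) • T (g k), fun k => b (g k), hqg,
    (hg.hasSum_iff hout).mpr hq1, fun k => ⟨?_, ?_⟩, b.orthonormal.comp g hg, ?_,
    LinearIsometryEquiv.refl ℂ H, fun k => F (g k), fun k => hpos _, fun k i j => ?_,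
    fun x y => (hg.hasSum_iff fun k hk => ?_).mpr (hF x y),
    fun X => (hg.hasSum_iff fun k hk => ?_).mpr (hΦF X)⟩
  · refine (hTpos (g k)).smul_of_nonneg ?_
    rw [← Complex.ofReal_inv]
    exact_mod_cast (inv_pos.mpr (hqg k)).le
  · rw [← traceL_apply, map_smul, traceL_apply, hTtr, smul_eq_mul, inv_mul_cancel₀ (hqC k)]
  · have h1 := (hg.hasSum_iff fun k hk => ?_).mpr hTσ
    · refine h1.congr_fun fun k => ?_
      rw [tensor_smul_left, smul_smul, mul_inv_cancel₀ (hqC k), one_smul]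
      rfl
    · rw [hTzero k (hout k hk)]
      exact (tensorL (rankOne (b k) (b k))).map_zero
  · have hij := hne i j
    rw [toOp_smul, smul_apply, inner_smul_right, hentry]
    have := hqC k
    push_cast
    field_simp
  · rw [hFzero k (hout k hk)]; simp
  · rw [hFzero k (hout k hk), mul_zero]
    have : trace (0 : H →L[ℂ] H) = 0 := (traceL H).map_zero
    rw [this, zero_smul]
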